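/- Let $\theta>0$, and let $|n\rangle$, $n\ge 0$, be the canonical orthonormal basis of $\ell^2(\mathbb N)$. Let $\mathfrak a,\mathfrak a^\dagger$ be the annihilation and creation operators, $\mathfrak a|n\rangle=\sqrt n\,|n-1\rangle$, $\mathfrak a^\dagger|n\rangle=\sqrt{n+1}\,|n+1\rangle$. The Schrödinger spectral triple of the Moyal plane is $(\mathcal A,\ \ell^2(\mathbb N)\otimes\mathbb C^2,\ D)$, where - $\mathcal A=\mathcal S(\mathbb N^2)$ is the $*$-algebra of rapid decay matrices, i.e. $(a_{mn})_{m,n\ge0}$ with $\sup_{m,n}(m+1)^k(n+1)^k|a_{mn}|<\infty$ for all $k\in\mathbb N$, acting on $\ell^2(\mathbb N)\otimes\mathbb C^2$ as $a\otimes 1$; - $D=\sqrt{\tfrac2\theta}\begin{pmatrix}0&\mathfrak a\\ \mathfrak a^\dagger&0\end{pmatrix}$, with domain the vectors ${}^t(v_1,v_2)$, $v_i\in\ell^2(\mathbb N)$, such that $\mathfrak a v_i$ and $\mathfrak a^\dagger v_i$ are square summable for $i=1,2$. For states $\varphi,\varphi'$ on $\mathcal A$ the spectral distance is $$d_D(\varphi,\varphi')=\sup\big\{\varphi(a)-\varphi'(a)\;:\;a=a^*\in\mathcal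 A,\ \|[D,a]\|\le 1\big\}\in[0,\infty].$$ For $z\in\mathbb C$ let $T(z)=\exp\big\{\tfrac1{\sqrt{2\theta}}(z\,\mathfrak a^\dagger-\bar z\,\mathfrak a)\big\}$, a unitary operator on $\ell^2(\mathbb N)$. Fix any $\psi_0\in\ell^2(\mathbb N)$ with $\|\psi_0\|=1$, and let $\Psi_z$ be the (generalized coherent) state $$\Psi_z(a)=\langle T(z)\psi_0,\ a\,T(z)\psi_0\rangle,\qquad a\in\mathcal A .$$ **Proposition.** For all $z,z'\in\mathbb C$, $$d_D(\Psi_z,\Psi_{z'})=|z-z'| .$$ -/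

import Mathlib

/-! ### Spectral distance -/

namespace SpectralTriple

noncomputable section

variable {H : Type*} [NormedAddCommGroup H] [InnerProductSpace ℂ H]

/-- The bounded operator `C` is the (extension to `H` of the) commutator `[D, a]` of the densely
defined operator `D` and the bounded operator `a`: the operator `a` preserves the domain of `D`,
and `D a v - a D v = C v` for all `v` in the domain of `D`. -/
def IsCommutator (D : H →ₗ.[ℂ] H) (a C : H →L[ℂ] H) : Prop :=
  ∀ v : D.domain, ∃ hv : a v ∈ D.domain, D ⟨a v, hv⟩ - a (D v) = C v

/-- The spectral distance
`sup {φ(a) - φ'(a) : a = a* ∈ A, ‖[D, a]‖ ≤ 1}`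
of two functionals on a `*`-algebra `A` represented by `π` on the Hilbert space `H` of `D`.
The values of states at self-adjoint elements are real. The supremum is taken in the extended
reals, since it may be infinite. -/
def spectralDistance [CompleteSpace H] {A : Type*} [NonUnitalRing A] [StarRing A] [Module ℂ A]
    (π : A →⋆ₙₐ[ℂ] (H →L[ℂ] H)) (D : H →ₗ.[ℂ] H) (φ φ' : A →ₗ[ℂ] ℂ) : EReal :=
  ⨆ a : {a : A // IsSelfAdjoint a ∧ ∃ C : H →L[ℂ] H, IsCommutator D (π a) C ∧ ‖C‖ ≤ 1},
    ((φ a - φ' a).re : EReal)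

end

end SpectralTriple

/-! ### The Schrödinger spectral triple of the Moyal plane -/

namespace Moyal

noncomputable section

/-- The Hilbert space `ℓ²(ℕ)`. -/
abbrev L2 : Type := lp (fun _ : ℕ => ℂ) 2

/-- The canonical orthonormal basis `|n⟩` of `ℓ²(ℕ)`. -/
def ket (n : ℕ) : L2 := lp.single 2 n 1

/-- The annihilation operator on arbitrary sequences: `𝔞|n⟩ = √n |n-1⟩`. -/
def annihilation : (ℕ → ℂ) →ₗ[ℂ] (ℕ → ℂ) where
  toFun v n := (Real.sqrt (n + 1) : ℂ) * v (n + 1)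
  map_add' u v := by ext n; simp [mul_add]
  map_smul' c v := by ext n; simp [mul_left_comm]

/-- The creation operator on arbitrary sequences: `𝔞†|n⟩ = √(n+1) |n+1⟩`. -/
def creation : (ℕ → ℂ) →ₗ[ℂ] (ℕ → ℂ) where
  toFun v n := (Real.sqrt n : ℂ) * v (n - 1)
  map_add' u v := by ext n; simp [mul_add]
  map_smul' c v := by ext n; simp [mul_left_comm]

lemma annihilation_single_zero : annihilation (Pi.single 0 1) = 0 := by
  ext m; simp [annihilation]

lemma annihilation_single_succ (n : ℕ) :
    annihilation (Pi.single (n + 1) 1) = (Real.sqrt (n + 1) : ℂ) • Pi.single n 1 := by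
  ext m
  by_cases h : m = n
  · subst h; simp [annihilation]
  · simp [annihilation, h]

lemma creation_single (n : ℕ) :
    creation (Pi.single n 1) = (Real.sqrt (n + 1) : ℂ) • Pi.single (n + 1) 1 := by
  ext m
  rcases m with _ | m
  · simp [creation]
  · by_cases h : m = n
    · subst h; simp [creation]
    · simp [creation, h]

/-- The doubled Hilbert space `ℓ²(ℕ) ⊗ ℂ²`, as the Hilbert sum of two copies of `ℓ²(ℕ)`. -/
abbrev DoubledL2 : Type := WithLp 2 (L2 × L2)

/-- The domain of the Dirac operator: the vectors `(v₁, v₂)` for which all of `𝔞 vᵢ` and `𝔞† vᵢ`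
are square summable. -/
def diracDomain : Submodule ℂ DoubledL2 where
  carrier := {v | (Memℓp (annihilation v.fst) 2 ∧ Memℓp (creation v.fst) 2) ∧
    (Memℓp (annihilation v.snd) 2 ∧ Memℓp (creation v.snd) 2)}
  zero_mem' := by
    simp only [Set.mem_ofPred_eq, WithLp.zero_fst, WithLp.zero_snd, lp.coeFn_zero, map_zero]
    exact ⟨⟨zero_memℓp, zero_memℓp⟩, ⟨zero_memℓp, zero_memℓp⟩⟩
  add_mem' := by
    rintro u v ⟨⟨h1, h2⟩, h3, h4⟩ ⟨⟨k1, k2⟩, k3, k4⟩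
    simp only [Set.mem_ofPred_eq, WithLp.add_fst, WithLp.add_snd, lp.coeFn_add, map_add]
    exact ⟨⟨h1.add k1, h2.add k2⟩, h3.add k3, h4.add k4⟩
  smul_mem' := by
    rintro c v ⟨⟨h1, h2⟩, h3, h4⟩
    simp only [Set.mem_ofPred_eq, WithLp.smul_fst, WithLp.smul_snd, lp.coeFn_smul, map_smul]
    exact ⟨⟨h1.const_smul c, h2.const_smul c⟩, h3.const_smul c, h4.const_smul c⟩

/-- The Dirac operator `D (v₁, v₂) = √(2/θ) (𝔞 v₂, 𝔞† v₁)`. -/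
def dirac (θ : ℝ) : DoubledL2 →ₗ.[ℂ] DoubledL2 where
  domain := diracDomain
  toFun :=
    { toFun := fun v => (Real.sqrt (2 / θ) : ℂ) • WithLp.toLp 2
        ((⟨annihilation v.1.snd, v.2.2.1⟩ : L2), (⟨creation v.1.fst, v.2.1.2⟩ : L2))
      map_add' := by
        intro u v
        rw [← smul_add, ← WithLp.toLp_add]
        congr 2
        refine Prod.ext (lp.ext ?_) (lp.ext ?_)
        · simp only [Submodule.coe_add, WithLp.add_snd, lp.coeFn_add, map_add, Prod.fst_add]
        · simp only [Submodule.coe_add, WithLp.add_fst, lp.coeFn_add, map_add, Prod.snd_add]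
      map_smul' := by
        intro c v
        rw [RingHom.id_apply, smul_comm, ← WithLp.toLp_smul]
        congr 2
        ext n <;> simp [annihilation, creation] }

/-- The infinite matrix `(a m n)` is of rapid decay. -/
def RapidDecay (a : ℕ → ℕ → ℂ) : Prop :=
  ∀ k : ℕ, ∃ C : ℝ, ∀ m n : ℕ, ((m : ℝ) + 1) ^ k * ((n : ℝ) + 1) ^ k * ‖a m n‖ ≤ C

/-- The matrix entry `⟨m|a|n⟩`. -/
def entry (a : L2 →L[ℂ] L2) (m n : ℕ) : ℂ := inner ℂ (ket m) (a (ket n))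

lemma entry_eq (a : L2 →L[ℂ] L2) (m n : ℕ) : entry a m n = a (ket n) m := by
  simp [entry, ket, lp.inner_single_left]

lemma entry_star (a : L2 →L[ℂ] L2) (m n : ℕ) : entry (star a) m n = star (entry a n m) := by
  simp only [entry, ContinuousLinearMap.star_eq_adjoint, ContinuousLinearMap.adjoint_inner_right]
  exact (inner_conj_symm _ _).symm

lemma RapidDecay.star {a : L2 →L[ℂ] L2} (ha : RapidDecay (entry a)) :
    RapidDecay (entry (Star.star a)) := by
  intro k
  obtain ⟨C, hC⟩ := ha k
  refine ⟨C, fun m n => ?_⟩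
  rw [entry_star, norm_star, mul_comm (((m : ℝ) + 1) ^ k)]
  exact hC n m

lemma RapidDecay.norm_apply_ket {a : L2 →L[ℂ] L2} (ha : RapidDecay (entry a)) (k : ℕ) :
    ∃ C : ℝ, ∀ n : ℕ, ((n : ℝ) + 1) ^ k * ‖a (ket n)‖ ≤ C := by
  obtain ⟨C, hC⟩ := ha (k + 1)
  have hC0 : 0 ≤ C := le_trans (by positivity) (hC 0 0)
  have hs : Summable fun m : ℕ => 1 / ((m : ℝ) + 1) ^ 2 := by
    have := (summable_nat_add_iff 1).2 (Real.summable_one_div_nat_pow.2 (by norm_num : 1 < 2))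
    simpa using this
  refine ⟨Real.sqrt (C ^ 2 * ∑' m : ℕ, 1 / ((m : ℝ) + 1) ^ 2), fun n => ?_⟩
  apply Real.le_sqrt_of_sq_le
  rw [mul_pow]
  have h2 : ‖a (ket n)‖ ^ 2 = ∑' m, ‖a (ket n) m‖ ^ 2 := by
    have := lp.norm_rpow_eq_tsum (p := 2) (by norm_num) (a (ket n))
    simpa using this
  have hsum : Summable fun m => ‖a (ket n) m‖ ^ 2 := by
    have := (lp.memℓp (a (ket n))).summable (by norm_num)
    simpa using this
  rw [h2, ← tsum_mul_left, ← tsum_mul_left]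
  refine Summable.tsum_le_tsum (fun m => ?_) (hsum.mul_left _) (hs.mul_left _)
  have h := hC m n
  rw [entry_eq] at h
  have hm : (0 : ℝ) < (m : ℝ) + 1 := by positivity
  have hn : (1 : ℝ) ≤ (n : ℝ) + 1 := by simp
  rw [mul_one_div, le_div_iff₀ (by positivity)]
  have h1 : ((n : ℝ) + 1) ^ k * ‖a (ket n) m‖ * ((m : ℝ) + 1) ≤ C := by
    refine le_trans ?_ h
    have e1 : ((n : ℝ) + 1) ^ k ≤ ((n : ℝ) + 1) ^ (k + 1) := pow_le_pow_right₀ hn (by simp)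
    have e2 : ((m : ℝ) + 1) ≤ ((m : ℝ) + 1) ^ (k + 1) := le_self_pow₀ (by simp) (by simp)
    calc ((n : ℝ) + 1) ^ k * ‖a (ket n) m‖ * ((m : ℝ) + 1)
        = ((m : ℝ) + 1) * ((n : ℝ) + 1) ^ k * ‖a (ket n) m‖ := by ring
      _ ≤ _ := by gcongr
  calc (((n : ℝ) + 1) ^ k) ^ 2 * ‖a (ket n) m‖ ^ 2 * ((m : ℝ) + 1) ^ 2
      = (((n : ℝ) + 1) ^ k * ‖a (ket n) m‖ * ((m : ℝ) + 1)) ^ 2 := by ring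
    _ ≤ C ^ 2 := by gcongr

/-- The algebra `𝒮(ℕ²)` of rapid decay matrices. A rapid decay matrix is identified with the
bounded operator on `ℓ²(ℕ)` that it defines. -/
def rapidDecayAlgebra : NonUnitalStarSubalgebra ℂ (L2 →L[ℂ] L2) where
  carrier := {a | RapidDecay (entry a)}
  zero_mem' := fun k => ⟨0, fun m n => by simp [entry]⟩
  add_mem' := by
    intro a b ha hb k
    obtain ⟨C, hC⟩ := ha k
    obtain ⟨C', hC'⟩ := hb k
    refine ⟨C + C', fun m n => ?_⟩
    have h : entry (a + b) m n = entry a m n + entry b m n := by simp [entry]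
    rw [h]
    refine le_trans ?_ (add_le_add (hC m n) (hC' m n))
    rw [← mul_add]
    gcongr
    exact norm_add_le _ _
  smul_mem' := by
    intro c a ha k
    obtain ⟨C, hC⟩ := ha k
    refine ⟨‖c‖ * C, fun m n => ?_⟩
    have h : entry (c • a) m n = c * entry a m n := by simp [entry]
    rw [h, norm_mul, mul_left_comm]
    gcongr
    exact hC m n
  mul_mem' := by
    intro a b ha hb k
    obtain ⟨C, hC⟩ := ha.star.norm_apply_ket k
    obtain ⟨C', hC'⟩ := hb.norm_apply_ket k
    refine ⟨C * C', fun m n => ?_⟩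
    have h : entry (a * b) m n = inner ℂ (star a (ket m)) (b (ket n)) := by
      simp [entry, ContinuousLinearMap.star_eq_adjoint, ContinuousLinearMap.adjoint_inner_left]
    rw [h]
    calc ((m : ℝ) + 1) ^ k * ((n : ℝ) + 1) ^ k * ‖inner ℂ (star a (ket m)) (b (ket n))‖
        ≤ ((m : ℝ) + 1) ^ k * ((n : ℝ) + 1) ^ k * (‖star a (ket m)‖ * ‖b (ket n)‖) := by
          gcongr; exact norm_inner_le_norm _ _
      _ = (((m : ℝ) + 1) ^ k * ‖star a (ket m)‖) * (((n : ℝ) + 1) ^ k * ‖b (ket n)‖) := by ring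
      _ ≤ C * C' := mul_le_mul (hC m) (hC' n) (by positivity) (le_trans (by positivity) (hC m))
  star_mem' := fun ha => ha.star

/-- The operator `a ⊗ 1` on `ℓ²(ℕ) ⊗ ℂ²`. -/
def doubled (a : L2 →L[ℂ] L2) : DoubledL2 →L[ℂ] DoubledL2 :=
  (WithLp.prodContinuousLinearEquiv 2 ℂ L2 L2).symm.toContinuousLinearMap ∘L
    (a.prodMap a) ∘L (WithLp.prodContinuousLinearEquiv 2 ℂ L2 L2).toContinuousLinearMap

lemma doubled_apply (a : L2 →L[ℂ] L2) (v : DoubledL2) :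
    doubled a v = WithLp.toLp 2 (a v.fst, a v.snd) := rfl

/-- The representation `a ↦ a ⊗ 1` of the rapid decay matrices on `ℓ²(ℕ) ⊗ ℂ²`. -/
def schrodingerRep : rapidDecayAlgebra →⋆ₙₐ[ℂ] (DoubledL2 →L[ℂ] DoubledL2) where
  toFun a := doubled a
  map_smul' c a := by ext v : 1; simp [doubled_apply, ← WithLp.toLp_smul]
  map_zero' := by ext v : 1; simp [doubled_apply]
  map_add' a b := by ext v : 1; simp [doubled_apply, ← WithLp.toLp_add]
  map_mul' a b := by ext v : 1; simp [doubled_apply]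
  map_star' a := by
    rw [ContinuousLinearMap.star_eq_adjoint, ContinuousLinearMap.eq_adjoint_iff]
    intro u v
    simp [doubled_apply, WithLp.prod_inner_apply, ContinuousLinearMap.star_eq_adjoint,
      ContinuousLinearMap.adjoint_inner_left]

/-! ### Translation operators and generalized coherent states -/

/-- The operator `(1/√(2θ)) (z 𝔞† - z̄ 𝔞)` on sequences. -/
def generator (θ : ℝ) (z : ℂ) : (ℕ → ℂ) →ₗ[ℂ] (ℕ → ℂ) :=
  ((1 / Real.sqrt (2 * θ) : ℝ) : ℂ) • (z • creation - (starRingEnd ℂ z) • annihilation)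

lemma memℓp_zero_annihilation {v : ℕ → ℂ} (hv : Memℓp v 0) : Memℓp (annihilation v) 0 := by
  rw [memℓp_zero_iff] at hv ⊢
  refine (hv.preimage (f := fun n => n + 1) (fun _ _ _ _ h => by simpa using h)).subset ?_
  intro n hn
  simp only [Set.mem_preimage, Set.mem_ofPred_eq] at hn ⊢
  intro h
  exact hn (by simp [annihilation, h])

lemma memℓp_zero_creation {v : ℕ → ℂ} (hv : Memℓp v 0) : Memℓp (creation v) 0 := by
  rw [memℓp_zero_iff] at hv ⊢
  refine (hv.image (fun n => n + 1)).subset ?_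
  intro n hn
  simp only [Set.mem_image, Set.mem_ofPred_eq] at hn ⊢
  rcases n with _ | n
  · exact absurd (by simp [creation]) hn
  · refine ⟨n, fun h => hn ?_, rfl⟩
    simp [creation, h]

lemma memℓp_zero_generator (θ : ℝ) (z : ℂ) {v : ℕ → ℂ} (hv : Memℓp v 0) :
    Memℓp (generator θ z v) 0 := by
  have h1 : Memℓp (z • creation v) 0 := (memℓp_zero_creation hv).const_smul z
  have h2 : Memℓp ((starRingEnd ℂ z) • annihilation v) 0 :=
    (memℓp_zero_annihilation hv).const_smul _
  have h3 : Memℓp (((1 / Real.sqrt (2 * θ) : ℝ) : ℂ) •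
      (z • creation v - (starRingEnd ℂ z) • annihilation v)) 0 := (h1.sub h2).const_smul _
  exact h3

lemma memℓp_zero_generator_pow (θ : ℝ) (z : ℂ) (k n : ℕ) :
    Memℓp ((generator θ z ^ k) (Pi.single n 1)) 0 := by
  induction k with
  | zero =>
    refine memℓp_zero ((Set.finite_singleton n).subset fun m hm => ?_)
    by_contra h
    exact hm (by simp [Pi.single_eq_of_ne (show m ≠ n from h)])
  | succ k ih =>
    rw [pow_succ']
    exact memℓp_zero_generator θ z ih

/-- The vector `Aᵏ|n⟩` of `ℓ²(ℕ)`, where `A = (1/√(2θ)) (z 𝔞† - z̄ 𝔞)`. -/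
def generatorPowKet (θ : ℝ) (z : ℂ) (k n : ℕ) : L2 :=
  ⟨(generator θ z ^ k) (Pi.single n 1), (memℓp_zero_generator_pow θ z k n).of_exponent_ge zero_le⟩

/-- The vector `exp(A)|n⟩ = ∑ₖ (1/k!) Aᵏ|n⟩`, where `A = (1/√(2θ)) (z 𝔞† - z̄ 𝔞)`. -/
def expKet (θ : ℝ) (z : ℂ) (n : ℕ) : L2 :=
  ∑' k : ℕ, ((k.factorial : ℂ)⁻¹) • generatorPowKet θ z k n

lemma norm_generatorPowKet_le (θ : ℝ) (z : ℂ) (k n : ℕ) :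
    ‖generatorPowKet θ z k n‖ ≤
      ∏ j ∈ Finset.range k, 2 * ((1 / Real.sqrt (2 * θ)) * ‖z‖) * Real.sqrt (n + j + 1) := by
  set β : ℝ := (1 / Real.sqrt (2 * θ)) * ‖z‖ with hβ
  have hβ0 : 0 ≤ β := by positivity
  have hmono : ∀ k (m n : ℕ), m ≤ n →
      ∏ j ∈ Finset.range k, 2 * β * Real.sqrt (m + j + 1) ≤
        ∏ j ∈ Finset.range k, 2 * β * Real.sqrt (n + j + 1) := by
    intro k m n h
    refine Finset.prod_le_prod (fun _ _ => by positivity) fun j _ => ?_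
    gcongr
  induction k generalizing n with
  | zero =>
    have : generatorPowKet θ z 0 n = ket n := by
      ext m; simp [generatorPowKet, ket]
    simp [this, ket]
  | succ k ih =>
    have hc : ‖((1 / Real.sqrt (2 * θ) : ℝ) : ℂ)‖ = 1 / Real.sqrt (2 * θ) := by
      rw [Complex.norm_real, Real.norm_of_nonneg (by positivity)]
    have hs : ‖((Real.sqrt ((n : ℝ) + 1) : ℝ) : ℂ)‖ = Real.sqrt (n + 1) := by
      rw [Complex.norm_real, Real.norm_of_nonneg (by positivity)]
    have hP : ∏ j ∈ Finset.range (k + 1), 2 * β * Real.sqrt (n + j + 1) =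
        2 * (β * Real.sqrt (n + 1) *
          ∏ j ∈ Finset.range k, 2 * β * Real.sqrt ((n + 1 : ℕ) + j + 1)) := by
      rw [Finset.prod_range_succ']
      simp only [Nat.cast_add, Nat.cast_one, Nat.cast_zero, add_zero]
      have : ∀ j : ℕ, (n : ℝ) + (j + 1) + 1 = n + 1 + j + 1 := fun j => by ring
      simp only [this]
      ring
    rw [hP]
    have h1 : ‖(((1 / Real.sqrt (2 * θ) : ℝ) : ℂ) * z * (Real.sqrt ((n : ℝ) + 1) : ℂ)) •
        generatorPowKet θ z k (n + 1)‖ ≤ β * Real.sqrt (n + 1) *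
          ∏ j ∈ Finset.range k, 2 * β * Real.sqrt ((n + 1 : ℕ) + j + 1) := by
      rw [norm_smul, norm_mul, norm_mul, hc, hs]
      exact mul_le_mul_of_nonneg_left (ih (n + 1)) (by positivity)
    rcases n with _ | n
    · have : generatorPowKet θ z (k + 1) 0 =
          (((1 / Real.sqrt (2 * θ) : ℝ) : ℂ) * z * (Real.sqrt (((0 : ℕ) : ℝ) + 1) : ℂ)) •
            generatorPowKet θ z k (0 + 1) := by
        apply lp.ext
        simp only [lp.coeFn_smul, generatorPowKet, pow_succ, Module.End.mul_apply]
        rw [← map_smul]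
        congr 1
        simp only [generator, LinearMap.smul_apply, LinearMap.sub_apply, creation_single,
          annihilation_single_zero, smul_zero, sub_zero, smul_smul, mul_assoc]
      rw [this]
      refine h1.trans (le_mul_of_one_le_left (by positivity) one_le_two)
    · have : generatorPowKet θ z (k + 1) (n + 1) =
          (((1 / Real.sqrt (2 * θ) : ℝ) : ℂ) * z * (Real.sqrt (((n + 1 : ℕ) : ℝ) + 1) : ℂ)) •
            generatorPowKet θ z k (n + 1 + 1) -
          (((1 / Real.sqrt (2 * θ) : ℝ) : ℂ) * (starRingEnd ℂ z) * (Real.sqrt ((n : ℝ) + 1) : ℂ)) •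
            generatorPowKet θ z k n := by
        apply lp.ext
        simp only [lp.coeFn_smul, lp.coeFn_sub, generatorPowKet, pow_succ, Module.End.mul_apply]
        rw [← map_smul, ← map_smul, ← map_sub]
        congr 1
        simp only [generator, LinearMap.smul_apply, LinearMap.sub_apply, creation_single,
          annihilation_single_succ, smul_sub, smul_smul, mul_assoc]
      rw [this]
      refine ((norm_sub_le _ _).trans (add_le_add h1 ?_)).trans_eq (two_mul _).symm
      have hs' : ‖((Real.sqrt ((n : ℝ) + 1) : ℝ) : ℂ)‖ = Real.sqrt (n + 1) := by
        rw [Complex.norm_real, Real.norm_of_nonneg (by positivity)]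
      rw [norm_smul, norm_mul, norm_mul, hc, hs', RCLike.norm_conj]
      refine mul_le_mul ?_ ((ih n).trans (hmono k n _ (by omega))) (norm_nonneg _) (by positivity)
      gcongr
      simp

/-- The exponential series converges absolutely on the basis vectors. -/
lemma summable_norm_expKet (θ : ℝ) (z : ℂ) (n : ℕ) :
    Summable fun k : ℕ => ‖((k.factorial : ℂ)⁻¹) • generatorPowKet θ z k n‖ := by
  set β : ℝ := (1 / Real.sqrt (2 * θ)) * ‖z‖ with hβ
  have hβ0 : 0 ≤ β := by positivity
  refine Summable.of_nonneg_of_le (fun _ => norm_nonneg _) (g := _)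
    (f := fun k : ℕ => (k.factorial : ℝ)⁻¹ *
      ∏ j ∈ Finset.range k, (2 * β + 1) * Real.sqrt (n + j + 1)) (fun k => ?_) ?_
  · rw [norm_smul, norm_inv, Complex.norm_natCast]
    refine mul_le_mul_of_nonneg_left ((norm_generatorPowKet_le θ z k n).trans ?_) (by positivity)
    refine Finset.prod_le_prod (fun _ _ => by positivity) fun j _ => ?_
    gcongr
    linarith
  · have hpos : ∀ k : ℕ, 0 < (k.factorial : ℝ)⁻¹ *
        ∏ j ∈ Finset.range k, (2 * β + 1) * Real.sqrt (n + j + 1) := by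
      intro k
      have : 0 < ∏ j ∈ Finset.range k, (2 * β + 1) * Real.sqrt (n + j + 1) :=
        Finset.prod_pos fun j _ => by positivity
      positivity
    refine summable_of_ratio_test_tendsto_lt_one (l := 0) one_pos
      (Filter.Eventually.of_forall fun k => (hpos k).ne') ?_
    have hr : ∀ k : ℕ, ‖((k + 1).factorial : ℝ)⁻¹ *
          ∏ j ∈ Finset.range (k + 1), (2 * β + 1) * Real.sqrt (n + j + 1)‖ /
        ‖(k.factorial : ℝ)⁻¹ * ∏ j ∈ Finset.range k, (2 * β + 1) * Real.sqrt (n + j + 1)‖ =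
        (2 * β + 1) * Real.sqrt (n + k + 1) / (k + 1) := by
      intro k
      rw [Real.norm_of_nonneg (hpos _).le, Real.norm_of_nonneg (hpos _).le,
        div_eq_iff (hpos k).ne', Finset.prod_range_succ, Nat.factorial_succ]
      push_cast
      field_simp
    simp only [hr]
    have hlim : Filter.Tendsto (fun k : ℕ => (2 * β + 1) * Real.sqrt (n + 1) / Real.sqrt (k + 1))
        Filter.atTop (nhds 0) := by
      refine Filter.Tendsto.div_atTop tendsto_const_nhds ?_
      exact Real.tendsto_sqrt_atTop.comp
        (Filter.tendsto_atTop_add_const_right _ _ tendsto_natCast_atTop_atTop)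
    refine squeeze_zero (fun k => by positivity) (fun k => ?_) hlim
    rw [div_le_div_iff₀ (by positivity) (by positivity), mul_assoc, mul_assoc]
    refine mul_le_mul_of_nonneg_left ?_ (by positivity)
    have e : ((k : ℝ) + 1) = Real.sqrt (k + 1) * Real.sqrt (k + 1) :=
      (Real.mul_self_sqrt (by positivity)).symm
    rw [show Real.sqrt ((n : ℝ) + 1) * ((k : ℝ) + 1) =
      (Real.sqrt (n + 1) * Real.sqrt (k + 1)) * Real.sqrt (k + 1) by rw [mul_assoc, ← e]]
    gcongr
    rw [← Real.sqrt_mul (by positivity)]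
    gcongr
    nlinarith [mul_nonneg (Nat.cast_nonneg (α := ℝ) n) (Nat.cast_nonneg (α := ℝ) k)]

lemma tsum_inner_creation (u v : ℕ → ℂ) (hu : Memℓp u 0) :
    ∑' n, inner ℂ (creation u n) (v n) = ∑' n, inner ℂ (u n) (annihilation v n) := by
  have hs : Summable fun n => inner ℂ (creation u n) (v n) := by
    refine summable_of_hasFiniteSupport ((memℓp_zero_iff.1 (memℓp_zero_creation hu)).subset ?_)
    intro n hn h
    exact hn (by simp [h])
  rw [hs.tsum_eq_zero_add]
  simp [creation, annihilation, mul_comm, mul_assoc]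

lemma tsum_inner_annihilation (u v : ℕ → ℂ) (hv : Memℓp v 0) :
    ∑' n, inner ℂ (annihilation u n) (v n) = ∑' n, inner ℂ (u n) (creation v n) := by
  have h := congrArg (starRingEnd ℂ) (tsum_inner_creation v u hv)
  rw [Complex.conj_tsum, Complex.conj_tsum] at h
  simpa only [inner_conj_symm] using h.symm

/-- `A` is skew-symmetric on finite sequences. -/
lemma inner_generator (θ : ℝ) (z : ℂ) (u v : ℕ → ℂ) (hu : Memℓp u 0) (hv : Memℓp v 0) :
    ∑' n, inner ℂ (generator θ z u n) (v n) = -∑' n, inner ℂ (u n) (generator θ z v n) := by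
  have sm : ∀ f g : ℕ → ℂ, Memℓp g 0 → Summable fun n => inner ℂ (f n) (g n) := by
    intro f g hg
    refine summable_of_hasFiniteSupport ((memℓp_zero_iff.1 hg).subset ?_)
    intro n hn h
    exact hn (by simp [h])
  set c : ℝ := 1 / Real.sqrt (2 * θ)
  have e1 : ∀ n, inner ℂ (generator θ z u n) (v n) =
      c * ((starRingEnd ℂ z) * inner ℂ (creation u n) (v n)
        - z * inner ℂ (annihilation u n) (v n)) := by
    intro n
    simp [generator, c]
    ring
  have e2 : ∀ n, inner ℂ (u n) (generator θ z v n) =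
      c * (z * inner ℂ (u n) (creation v n)
        - (starRingEnd ℂ z) * inner ℂ (u n) (annihilation v n)) := by
    intro n
    simp [generator, c]
    ring
  simp only [e1, e2]
  rw [tsum_mul_left, tsum_mul_left,
    ((sm _ _ hv).mul_left _).tsum_sub ((sm _ _ hv).mul_left _),
    ((sm _ _ (memℓp_zero_creation hv)).mul_left _).tsum_sub
      ((sm _ _ (memℓp_zero_annihilation hv)).mul_left _),
    tsum_mul_left, tsum_mul_left, tsum_mul_left, tsum_mul_left, tsum_inner_creation u v hu,
    tsum_inner_annihilation u v hv]
  ring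

lemma inner_generatorPowKet_succ (θ : ℝ) (z : ℂ) (j k m n : ℕ) :
    inner ℂ (generatorPowKet θ z (j + 1) m) (generatorPowKet θ z k n) =
      -inner ℂ (generatorPowKet θ z j m) (generatorPowKet θ z (k + 1) n) := by
  rw [lp.inner_eq_tsum, lp.inner_eq_tsum]
  simp only [generatorPowKet, pow_succ' (generator θ z), Module.End.mul_apply]
  exact inner_generator θ z _ _ (memℓp_zero_generator_pow θ z j m)
    (memℓp_zero_generator_pow θ z k n)

lemma inner_generatorPowKet (θ : ℝ) (z : ℂ) (j k m n : ℕ) :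
    inner ℂ (generatorPowKet θ z j m) (generatorPowKet θ z k n) =
      (-1) ^ j * inner ℂ (ket m) (generatorPowKet θ z (j + k) n) := by
  induction j generalizing k with
  | zero =>
    have : generatorPowKet θ z 0 m = ket m := by
      ext i; simp [generatorPowKet, ket]
    simp [this]
  | succ j ih =>
    rw [inner_generatorPowKet_succ, ih, pow_succ, show j + (k + 1) = j + 1 + k by ring]
    ring

lemma sum_antidiagonal_exp (N : ℕ) :
    ∑ p ∈ Finset.HasAntidiagonal.antidiagonal N,
      (-1 : ℂ) ^ p.1 * ((p.1.factorial : ℂ)⁻¹ * (p.2.factorial : ℂ)⁻¹) =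
      if N = 0 then 1 else 0 := by
  have h : ∑ p ∈ Finset.HasAntidiagonal.antidiagonal N,
      (-1 : ℂ) ^ p.1 * ((p.1.factorial : ℂ)⁻¹ * (p.2.factorial : ℂ)⁻¹) =
      (N.factorial : ℂ)⁻¹ * ((-1 : ℂ) + 1) ^ N := by
    rw [add_pow, ← Finset.Nat.sum_antidiagonal_eq_sum_range_succ
      (fun i j => (-1 : ℂ) ^ i * 1 ^ j * (N.choose i : ℂ)), Finset.mul_sum]
    refine Finset.sum_congr rfl fun p hp => ?_
    obtain rfl := Finset.HasAntidiagonal.mem_antidiagonal.1 hp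
    rw [Nat.choose_symm_add, Nat.add_choose, Nat.cast_div (Nat.factorial_mul_factorial_dvd_factorial_add _ _)
      (by exact_mod_cast (by positivity))]
    have h1 : ((p.1 + p.2).factorial : ℂ) ≠ 0 := by exact_mod_cast Nat.factorial_ne_zero _
    have h2 : (p.1.factorial : ℂ) ≠ 0 := by exact_mod_cast Nat.factorial_ne_zero _
    have h3 : (p.2.factorial : ℂ) ≠ 0 := by exact_mod_cast Nat.factorial_ne_zero _
    push_cast
    field_simp
    simp
  rw [h]
  split_ifs with h0
  · simp [h0]
  · simp [h0]

lemma inner_tsum_tsum {E : Type*} [NormedAddCommGroup E] [InnerProductSpace ℂ E]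
    [CompleteSpace E] (x y : ℕ → E) (hx : Summable fun k => ‖x k‖) (hy : Summable fun k => ‖y k‖) :
    (Summable fun p : ℕ × ℕ => inner ℂ (x p.1) (y p.2)) ∧
      inner ℂ (∑' k, x k) (∑' k, y k) = ∑' p : ℕ × ℕ, inner ℂ (x p.1) (y p.2) := by
  have hp : Summable fun p : ℕ × ℕ => inner ℂ (x p.1) (y p.2) := by
    refine Summable.of_norm_bounded (g := fun p : ℕ × ℕ => ‖x p.1‖ * ‖y p.2‖) ?_
      (fun p => norm_inner_le_norm _ _)
    exact hx.mul_of_nonneg hy (fun _ => norm_nonneg _) (fun _ => norm_nonneg _)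
  refine ⟨hp, ?_⟩
  rw [hp.tsum_prod]
  have hy' : ∀ i, ∑' k, inner ℂ (x i) (y k) = inner ℂ (x i) (∑' k, y k) := fun i =>
    ((innerSL ℂ (x i)).hasSum hy.of_norm.hasSum).tsum_eq
  simp only [hy']
  have h := ((innerSL ℂ (∑' k, y k)).hasSum hx.of_norm.hasSum).map (starRingEnd ℂ)
    Complex.continuous_conj
  have h2 := h.tsum_eq
  simp only [Function.comp_def, innerSL_apply_apply, inner_conj_symm] at h2
  exact h2.symm

lemma inner_expKet (θ : ℝ) (z : ℂ) (m n : ℕ) :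
    inner ℂ (expKet θ z m) (expKet θ z n) = inner ℂ (ket m) (ket n) := by
  have s1 := summable_norm_expKet θ z m
  have s2 := summable_norm_expKet θ z n
  set x : ℕ → L2 := fun k => ((k.factorial : ℂ)⁻¹) • generatorPowKet θ z k m
  set y : ℕ → L2 := fun k => ((k.factorial : ℂ)⁻¹) • generatorPowKet θ z k n
  obtain ⟨hp, h1⟩ := inner_tsum_tsum x y s1 s2
  rw [expKet, expKet, h1, ← Finset.HasAntidiagonal.sigmaAntidiagonalEquivProd.tsum_eq
    (fun p : ℕ × ℕ => inner ℂ (x p.1) (y p.2))]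
  have hq := (Finset.HasAntidiagonal.sigmaAntidiagonalEquivProd.summable_iff.2 hp).tsum_sigma
  simp only [Function.comp_def] at hq
  rw [hq]
  have hN : ∀ N : ℕ, ∑' p : Finset.HasAntidiagonal.antidiagonal N,
      inner ℂ (x p.1.1) (y p.1.2) =
      (if N = 0 then 1 else 0) * inner ℂ (ket m) (generatorPowKet θ z N n) := by
    intro N
    rw [Finset.tsum_subtype (Finset.HasAntidiagonal.antidiagonal N) (fun p : ℕ × ℕ => inner ℂ (x p.1) (y p.2)),
      ← sum_antidiagonal_exp, Finset.sum_mul]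
    refine Finset.sum_congr rfl fun p hp => ?_
    obtain rfl := Finset.HasAntidiagonal.mem_antidiagonal.1 hp
    simp only [x, y, inner_smul_left, inner_smul_right, inner_generatorPowKet, map_inv₀,
      Complex.conj_natCast]
    ring
  have h0 : generatorPowKet θ z 0 n = ket n := by
    ext i; simp [generatorPowKet, ket]
  refine (tsum_congr hN).trans ?_
  rw [tsum_eq_single 0 (fun N hN => by simp [hN])]
  simp [h0]

lemma orthonormal_ket : Orthonormal ℂ ket := by
  rw [orthonormal_iff_ite]
  intro i j
  simp only [ket, lp.inner_single_left, lp.single_apply]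
  by_cases h : i = j
  · subst h; simp
  · simp [h]

lemma orthonormal_expKet (θ : ℝ) (z : ℂ) : Orthonormal ℂ (expKet θ z) := by
  rw [orthonormal_iff_ite]
  intro i j
  rw [inner_expKet]
  exact orthonormal_iff_ite.1 orthonormal_ket i j

lemma generatorPowKet_neg (θ : ℝ) (z : ℂ) (k n : ℕ) :
    generatorPowKet θ (-z) k n = (-1 : ℂ) ^ k • generatorPowKet θ z k n := by
  have h : generator θ (-z) = (-1 : ℂ) • generator θ z := by
    simp only [generator, map_neg]
    module
  apply lp.ext
  simp only [generatorPowKet, h, smul_pow, lp.coeFn_smul, LinearMap.smul_apply]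

lemma inner_expKet_ket (θ : ℝ) (z : ℂ) (m n : ℕ) :
    inner ℂ (expKet θ (-z) m) (ket n) = inner ℂ (ket m) (expKet θ z n) := by
  have h0 : generatorPowKet θ z 0 n = ket n := by
    ext i; simp [generatorPowKet, ket]
  have hz : HasSum (fun k : ℕ => ((k.factorial : ℂ)⁻¹) • generatorPowKet θ z k n)
      (expKet θ z n) := (summable_norm_expKet θ z n).of_norm.hasSum
  have hw : HasSum (fun k : ℕ => ((k.factorial : ℂ)⁻¹) • generatorPowKet θ (-z) k m)
      (expKet θ (-z) m) := (summable_norm_expKet θ (-z) m).of_norm.hasSum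
  have h1 := (innerSL ℂ (ket m)).hasSum hz
  have h2 := ((innerSL ℂ (ket n)).hasSum hw).map (starRingEnd ℂ) Complex.continuous_conj
  simp only [Function.comp_def, innerSL_apply_apply, inner_conj_symm] at h1 h2
  refine h2.unique (h1.congr_fun ?_)
  intro k
  rw [generatorPowKet_neg, inner_smul_left, inner_smul_left, inner_smul_right, ← h0,
    inner_generatorPowKet]
  simp only [map_inv₀, Complex.conj_natCast, map_pow, map_neg, map_one, add_zero]
  rw [← mul_assoc ((-1 : ℂ) ^ k), ← mul_pow]
  simp

/-- The operator `T(z)`, as an isometry: the isometry mapping `|n⟩` to `exp(A)|n⟩`. -/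
def translationIsometry (θ : ℝ) (z : ℂ) : L2 →ₗᵢ[ℂ] L2 :=
  (orthonormal_expKet θ z).orthogonalFamily.linearIsometry

lemma translationIsometry_ket (θ : ℝ) (z : ℂ) (n : ℕ) :
    translationIsometry θ z (ket n) = expKet θ z n := by
  simp [translationIsometry, ket, OrthogonalFamily.linearIsometry_apply_single]

lemma hasSum_ket (v : L2) : HasSum (fun n => v n • ket n) v := by
  have h := lp.hasSum_single (p := 2) (by norm_num) v
  have e : ∀ n, v n • ket n = lp.single 2 n (v n) := fun n => by
    rw [ket, ← lp.single_smul]; simp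
  simpa only [e] using h

lemma inner_translationIsometry (θ : ℝ) (z : ℂ) (u v : L2) :
    inner ℂ (translationIsometry θ (-z) u) v = inner ℂ u (translationIsometry θ z v) := by
  have key : ∀ m (v : L2), inner ℂ (expKet θ (-z) m) v =
      inner ℂ (ket m) (translationIsometry θ z v) := by
    intro m v
    have h1 := (innerSL ℂ (expKet θ (-z) m)).hasSum (hasSum_ket v)
    have h2 := (innerSL ℂ (ket m)).hasSum
      ((translationIsometry θ z).toContinuousLinearMap.hasSum (hasSum_ket v))
    simp only [innerSL_apply_apply, map_smul, LinearIsometry.coe_toContinuousLinearMap,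
      translationIsometry_ket, smul_eq_mul, inner_expKet_ket] at h1 h2
    exact h1.unique h2
  have h1 := ((innerSL ℂ v).hasSum
    ((translationIsometry θ (-z)).toContinuousLinearMap.hasSum (hasSum_ket u))).map
      (starRingEnd ℂ) Complex.continuous_conj
  have h2 := ((innerSL ℂ (translationIsometry θ z v)).hasSum (hasSum_ket u)).map
    (starRingEnd ℂ) Complex.continuous_conj
  simp only [Function.comp_def, innerSL_apply_apply, inner_conj_symm, map_smul,
    LinearIsometry.coe_toContinuousLinearMap, translationIsometry_ket, smul_eq_mul, map_mul]
    at h1 h2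
  simp only [key] at h1 h2
  exact h1.unique h2

lemma translationIsometry_surjective (θ : ℝ) (z : ℂ) :
    Function.Surjective (translationIsometry θ z) := fun w =>
  ⟨translationIsometry θ (-z) w, ext_inner_left ℂ fun v => by
    rw [← inner_translationIsometry, LinearIsometry.inner_map_map]⟩

/-- The unitary translation operator `T(z) = exp((1/√(2θ)) (z 𝔞† - z̄ 𝔞))`. The exponential is given
by its power series on the basis vectors (they are analytic vectors of the skew-adjoint generator),
and extended linearly and isometrically to `ℓ²(ℕ)`: `T(z) v = ∑ₙ vₙ exp(A)|n⟩`. -/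
def translation (θ : ℝ) (z : ℂ) : L2 ≃ₗᵢ[ℂ] L2 :=
  LinearIsometryEquiv.ofSurjective (translationIsometry θ z) (translationIsometry_surjective θ z)

/-- The vector `|ψ_z⟩ = T(z)|ψ₀⟩`. -/
def coherentVector (θ : ℝ) (ψ₀ : L2) (z : ℂ) : L2 := translation θ z ψ₀

/-- The functional `Ψ_z(a) = ⟨ψ_z|a|ψ_z⟩` on the algebra of rapid decay matrices. -/
def coherentState (θ : ℝ) (ψ₀ : L2) (z : ℂ) : rapidDecayAlgebra →ₗ[ℂ] ℂ where
  toFun a := inner ℂ (coherentVector θ ψ₀ z) ((a : L2 →L[ℂ] L2) (coherentVector θ ψ₀ z))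
  map_add' a b := by simp
  map_smul' c a := by simp

end

end Moyal

namespace Moyal

noncomputable section

/-! ### Ladder operators and translations -/

/-! Write A_w = (w 𝔞† - w̄ 𝔞)/√(2θ) for the generator of t ↦ T(tw). Everything rests on two facts:
[𝔞, A_w] and [𝔞†, A_w] are scalars, and [D, f] consists of the two blocks √(2/θ)[𝔞, f] and
√(2/θ)[𝔞†, f].

Upper bound. If ‖[D, f]‖ ≤ 1, both [𝔞, f] and [𝔞†, f] have norm at most √(θ/2). The derivative of t
↦ ⟨T(tw)u, f T(tw)u⟩ is the expectation of a combination of these commutators with coefficients of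
modulus |w|/√(2θ), so it is at most |w|‖u‖². The mean value inequality gives the estimate for finite
vectors u, and density gives it for all u (`norm_expectation_translation_sub_le`). Since T(w)T(z) is
T(w + z) up to a phase (`translation_translation`), any pair z, z' reduces to w = z - z'.

Lower bound. The ideal observable is the position operator μ𝔞 + μ̄𝔞†, with μ of modulus √(θ/2) and
phase chosen along z - z': its commutators with the ladder operators are scalars, and T(z) shifts it
by a scalar. It is unbounded, so its matrix is multiplied by a logarithmic cut-off, which enlarges
the Lipschitz norm only by a factor 1 + 2ε (`exists_isCommutator_testOperator`). As ε → 0, the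
difference of expectations converges to |z - z'|‖u‖² when u lies in the domain of the ladder
operators (`tendsto_expectation_sub`).

The given ψ₀ need not lie in that domain, and the cut-off operators are not uniformly bounded. The
upper bound, however, controls the difference of expectations as a quadratic form uniformly over all
Lipschitz observables; with the parallelogram law this carries near-optimality from a finite vector
u to a nearby ψ₀ (`exists_lt_expectation_sub`). -/

/-- The creation operator is formally adjoint to the annihilation operator. -/
lemma inner_creation_left {u u₁ v v₁ : L2} (hu : creation ⇑u = ⇑u₁)
    (hv : annihilation ⇑v = ⇑v₁) : inner ℂ u₁ v = inner ℂ u v₁ := by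
  have h1 : HasSum (fun n => inner ℂ (u₁ n) (v n)) (inner ℂ u₁ v) := lp.hasSum_inner u₁ v
  have h2 : HasSum (fun n => inner ℂ (u n) (v₁ n)) (inner ℂ u v₁) := lp.hasSum_inner u v₁
  rw [← hu, ← hasSum_nat_add_iff' 1] at h1
  rw [← hv] at h2
  have h3 := h1.unique (h2.congr_fun fun n => ?_)
  · simpa [creation] using h3
  · simp [creation, annihilation, mul_left_comm, mul_assoc]

lemma annihilation_creation (x : ℕ → ℂ) :
    annihilation (creation x) = creation (annihilation x) + x := by
  ext n
  rcases n with _ | n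
  · simp [annihilation, creation]
  · have h1 : (Real.sqrt ((n : ℝ) + 1) : ℂ) * Real.sqrt ((n : ℝ) + 1) = (n : ℂ) + 1 := by
      rw [← Complex.ofReal_mul, Real.mul_self_sqrt (by positivity)]; push_cast; ring
    have h2 : (Real.sqrt ((n : ℝ) + 1 + 1) : ℂ) * Real.sqrt ((n : ℝ) + 1 + 1) = (n : ℂ) + 1 + 1 := by
      rw [← Complex.ofReal_mul, Real.mul_self_sqrt (by positivity)]; push_cast; ring
    simp only [annihilation, creation, LinearMap.coe_mk, AddHom.coe_mk, Pi.add_apply,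
      Nat.add_sub_cancel, Nat.cast_add, Nat.cast_one]
    rw [← mul_assoc, ← mul_assoc, h1, h2]
    ring

/-- The scale `1/√(2θ)` of the generator. -/
def scale (θ : ℝ) : ℂ := ((1 / Real.sqrt (2 * θ) : ℝ) : ℂ)

lemma conj_scale (θ : ℝ) : (starRingEnd ℂ) (scale θ) = scale θ := by
  rw [scale, Complex.conj_ofReal]

lemma generator_apply (θ : ℝ) (z : ℂ) (x : ℕ → ℂ) : generator θ z x =
    scale θ • (z • creation x - (starRingEnd ℂ z) • annihilation x) := rfl

/-- By [𝔞, 𝔞†] = 1 only the 𝔞† term of the generator contributes; for 𝔞† below, only the 𝔞 term. -/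
lemma annihilation_generator (θ : ℝ) (z : ℂ) (x : ℕ → ℂ) :
    annihilation (generator θ z x) = generator θ z (annihilation x) + (z * scale θ) • x := by
  simp only [generator_apply, map_smul, map_sub, annihilation_creation]
  module

lemma creation_generator (θ : ℝ) (z : ℂ) (x : ℕ → ℂ) :
    creation (generator θ z x) =
      generator θ z (creation x) + (starRingEnd ℂ z * scale θ) • x := by
  simp only [generator_apply, map_smul, map_sub, annihilation_creation]
  module

/-- An operator whose commutator with `A` is the scalar `c` satisfies `[L, Aᵏ⁺¹] = (k+1) c Aᵏ`. -/
lemma apply_pow_succ_of_commutator {V : Type*} [AddCommGroup V] [Module ℂ V]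
    {L A : Module.End ℂ V} {c : ℂ} (h : ∀ x, L (A x) = A (L x) + c • x) (k : ℕ) (x : V) :
    L ((A ^ (k + 1)) x) = (A ^ (k + 1)) (L x) + ((k + 1 : ℂ) * c) • (A ^ k) x := by
  induction k with
  | zero => simp [h]
  | succ k ih =>
    rw [pow_succ' A (k + 1), Module.End.mul_apply, h, ih, Module.End.mul_apply, map_add, map_smul,
      ← Module.End.mul_apply A (A ^ k), ← pow_succ']
    push_cast
    module

/-! ### Ladder operators on the exponential series -/

/-- At n = 0 the factor √0 makes the truncated index n - 1 harmless, so no case split on n is needed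
later. -/
lemma annihilation_single (n : ℕ) :
    annihilation (Pi.single n 1) = (Real.sqrt n : ℂ) • Pi.single (n - 1) 1 := by
  rcases n with _ | n
  · simp [annihilation_single_zero]
  · rw [annihilation_single_succ]; simp

lemma hasSum_expKet_apply (θ : ℝ) (z : ℂ) (n m : ℕ) :
    HasSum (fun k : ℕ => ((k.factorial : ℂ)⁻¹) * (generator θ z ^ k) (Pi.single n 1) m)
      (expKet θ z n m) := by
  have h := (summable_norm_expKet θ z n).of_norm.hasSum
  have h2 := (lp.evalCLM ℂ (fun _ : ℕ => ℂ) 2 m).hasSum h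
  exact h2

/-- Summation of the exponential series of a commutation relation `[L, A] = c`. -/
lemma apply_expKet {θ : ℝ} {z : ℂ} {L : (ℕ → ℂ) →ₗ[ℂ] (ℕ → ℂ)} {c s : ℂ} {n n' m i : ℕ} {r : ℂ}
    (h : ∀ x, L (generator θ z x) = generator θ z (L x) + c • x)
    (hn : L (Pi.single n 1) = s • Pi.single n' 1) (hL : ∀ x, L x m = r * x i) :
    L (expKet θ z n) m = s * expKet θ z n' m + c * expKet θ z n m := by
  have h1 := (hasSum_expKet_apply θ z n i).mul_left r
  have h2 := (hasSum_expKet_apply θ z n' m).mul_left s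
  have h3 := (hasSum_expKet_apply θ z n m).mul_left c
  -- [L, Aᵏ⁺¹/(k+1)!] = c Aᵏ/k!, so the two series involving L are shifted by one against the third.
  -- The k = 0 terms split off agree by `hn`.
  rw [← hasSum_nat_add_iff' 1] at h1 h2
  have h4 := h1.unique ((h2.add h3).congr_fun ?_)
  · simp only [Finset.sum_range_one, Nat.factorial_zero, Nat.cast_one, inv_one, one_mul, pow_zero,
      Module.End.one_apply, ← hL, hn] at h4
    simp only [Pi.smul_apply, smul_eq_mul] at h4
    linear_combination h4
  · intro k
    have e : r * (generator θ z ^ (k + 1)) (Pi.single n 1) i =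
        s * (generator θ z ^ (k + 1)) (Pi.single n' 1) m +
          (k + 1) * c * (generator θ z ^ k) (Pi.single n 1) m := by
      rw [← hL, apply_pow_succ_of_commutator h, hn, map_smul]
      simp
    rw [mul_left_comm, e, Nat.factorial_succ]
    have h0 : (k.factorial : ℂ) ≠ 0 := Nat.cast_ne_zero.2 k.factorial_ne_zero
    have h5 : (k : ℂ) + 1 ≠ 0 := Nat.cast_add_one_ne_zero k
    push_cast
    field_simp

lemma annihilation_expKet (θ : ℝ) (z : ℂ) (n : ℕ) :
    annihilation (expKet θ z n) =
      ⇑((Real.sqrt n : ℂ) • expKet θ z (n - 1) + (z * scale θ) • expKet θ z n) := by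
  ext m
  exact apply_expKet (annihilation_generator θ z) (annihilation_single n) (fun x => rfl)

lemma creation_expKet (θ : ℝ) (z : ℂ) (n : ℕ) :
    creation (expKet θ z n) =
      ⇑((Real.sqrt (n + 1) : ℂ) • expKet θ z (n + 1) +
        (starRingEnd ℂ z * scale θ) • expKet θ z n) := by
  ext m
  exact apply_expKet (creation_generator θ z) (creation_single n) (fun x => rfl)

lemma coe_ket (n : ℕ) : ⇑(ket n) = Pi.single n (1 : ℂ) := by
  ext m; simp [ket]

lemma inner_ket_left (n : ℕ) (v : L2) : inner ℂ (ket n) v = v n := by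
  simp [ket, lp.inner_single_left]

lemma creation_ket (n : ℕ) :
    creation (ket n) = ⇑((Real.sqrt (n + 1) : ℂ) • ket (n + 1)) := by
  rw [coe_ket, creation_single, lp.coeFn_smul, coe_ket]

lemma annihilation_ket (n : ℕ) :
    annihilation (ket n) = ⇑((Real.sqrt n : ℂ) • ket (n - 1)) := by
  rw [coe_ket, annihilation_single, lp.coeFn_smul, coe_ket]

lemma translation_ket (θ : ℝ) (z : ℂ) (n : ℕ) : translation θ z (ket n) = expKet θ z n :=
  translationIsometry_ket θ z n

lemma inner_translation (θ : ℝ) (z : ℂ) (u v : L2) :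
    inner ℂ (translation θ (-z) u) v = inner ℂ u (translation θ z v) :=
  inner_translationIsometry θ z u v

/-- Reading coordinates against T(-z)|m⟩ transfers the ladder operators from T(z)v to the
exponential vectors, where they are already computed. -/
lemma translation_apply_coord (θ : ℝ) (z : ℂ) (v : L2) (m : ℕ) :
    translation θ z v m = inner ℂ (expKet θ (-z) m) v := by
  rw [← translation_ket, inner_translation, inner_ket_left]

lemma translation_neg_apply (θ : ℝ) (z : ℂ) (v : L2) :
    translation θ z (translation θ (-z) v) = v := by
  refine ext_inner_left ℂ fun u => ?_
  rw [← inner_translation, LinearIsometryEquiv.inner_map_map]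

/-- `T(z)* 𝔞 T(z) = 𝔞 + z/√(2θ)`. -/
lemma annihilation_translation (θ : ℝ) (z : ℂ) {v v₁ : L2} (hv : annihilation ⇑v = ⇑v₁) :
    annihilation (translation θ z v) =
      ⇑(translation θ z v₁ + (z * scale θ) • translation θ z v) := by
  ext m
  have h1 := inner_creation_left (creation_expKet θ (-z) m) hv
  simp only [inner_add_left, inner_smul_left, map_mul, map_neg, Complex.conj_conj, conj_scale,
    Complex.conj_ofReal, ← translation_apply_coord] at h1
  change (Real.sqrt (m + 1) : ℂ) * _ = translation θ z v₁ m + (z * scale θ) * translation θ z v m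
  linear_combination h1

/-- `T(z)* 𝔞† T(z) = 𝔞† + z̄/√(2θ)`. -/
lemma creation_translation (θ : ℝ) (z : ℂ) {v v₁ : L2} (hv : creation ⇑v = ⇑v₁) :
    creation (translation θ z v) =
      ⇑(translation θ z v₁ + (starRingEnd ℂ z * scale θ) • translation θ z v) := by
  ext m
  have h1 := congrArg (starRingEnd ℂ) (inner_creation_left hv (annihilation_expKet θ (-z) m))
  simp only [inner_conj_symm, inner_add_left, inner_smul_left, map_mul, map_neg,
    conj_scale, Complex.conj_ofReal, ← translation_apply_coord] at h1
  change (Real.sqrt m : ℂ) * _ =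
    translation θ z v₁ m + (starRingEnd ℂ z * scale θ) * translation θ z v m
  linear_combination -h1

/-! ### Composition of translations up to a phase -/

/-- The kernel of the annihilation operator is spanned by the vacuum. -/
lemma eq_smul_ket_zero_of_annihilation_eq_zero {v : L2} (hv : annihilation ⇑v = 0) :
    v = v 0 • ket 0 := by
  apply lp.ext
  ext m
  rw [lp.coeFn_smul, coe_ket]
  rcases m with _ | m
  · simp
  · have h := congrFun hv m
    have h0 : (Real.sqrt ((m : ℝ) + 1) : ℂ) ≠ 0 := by
      rw [Complex.ofReal_ne_zero]; positivity
    simpa [annihilation, h0] using h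

lemma continuousLinearMap_ext_ket {E : Type*} [NormedAddCommGroup E] [NormedSpace ℂ E]
    {S T : L2 →L[ℂ] E} (h : ∀ n, S (ket n) = T (ket n)) : S = T := by
  ext v
  have h1 := S.hasSum (hasSum_ket v)
  have h2 := T.hasSum (hasSum_ket v)
  simp only [map_smul, h] at h1 h2
  exact h1.unique h2

/-- The translations form a projective representation of `ℂ`. -/
lemma translation_translation (θ : ℝ) (w z : ℂ) :
    ∃ c : ℂ, ‖c‖ = 1 ∧
      ∀ v, translation θ w (translation θ z v) = c • translation θ (w + z) v := by
  have ha0 : annihilation (ket 0) = ⇑(0 : L2) := by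
    rw [annihilation_ket, Nat.cast_zero, Real.sqrt_zero, Complex.ofReal_zero, zero_smul]
  have h1 := annihilation_translation θ w (annihilation_translation θ z ha0)
  have h2 := annihilation_translation θ (-(w + z)) h1
  -- The three scalar shifts of 𝔞 add up to zero, so this vector is a multiple of the vacuum; its
  -- coefficient is the phase c.
  have h3 : annihilation (translation θ (-(w + z)) (translation θ w (translation θ z (ket 0)))) = 0 := by
    rw [h2, ← lp.coeFn_zero]
    congr 1
    simp only [map_smul, map_zero, zero_add, ← add_smul]
    rw [show z * scale θ + w * scale θ + -(w + z) * scale θ = 0 by ring, zero_smul]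
  have h4 := eq_smul_ket_zero_of_annihilation_eq_zero h3
  generalize translation θ (-(w + z)) (translation θ w (translation θ z (ket 0))) 0 = c at h4
  -- The phase found on the vacuum propagates up the ladder: both sides shift 𝔞† by the same scalar,
  -- and 𝔞† generates |n+1⟩ from |n⟩.
  have h5 : ∀ n, translation θ w (translation θ z (ket n)) = c • translation θ (w + z) (ket n) := by
    intro n
    induction n with
    | zero =>
      have := congrArg (translation θ (w + z)) h4
      rwa [translation_neg_apply, map_smul] at this
    | succ n ih =>
      have e1 := creation_translation θ w (creation_translation θ z (creation_ket n))
      have e2 := creation_translation θ (w + z) (creation_ket n)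
      rw [ih, lp.coeFn_smul, map_smul, e2, ← lp.coeFn_smul] at e1
      have e3 := lp.ext e1
      simp only [map_add, map_smul, ih] at e3
      have h0 : (Real.sqrt ((n : ℝ) + 1) : ℂ) ≠ 0 := by
        rw [Complex.ofReal_ne_zero]; positivity
      apply smul_right_injective _ h0
      have e4 : ∀ {V : Type} [AddCommGroup V] [Module ℂ V] (p q r t s : ℂ) (x y x' : V),
          p • (q • x + ((r + t) * s) • y) = q • x' + (t * s) • p • y + (r * s) • p • y →
          q • x' = q • p • x := by
        intro V _ _ p q r t s x y x' h
        linear_combination (norm := module) (-1 : ℂ) • h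
      exact e4 _ _ _ _ _ _ _ _ e3
  refine ⟨c, ?_, ?_⟩
  · have := congrArg norm (h5 0)
    rw [norm_smul] at this
    simpa [orthonormal_ket.1 0] using this.symm
  · intro v
    have := continuousLinearMap_ext_ket
      (S := ((translation θ w).toContinuousLinearEquiv : L2 →L[ℂ] L2) ∘L
        ((translation θ z).toContinuousLinearEquiv : L2 →L[ℂ] L2))
      (T := c • ((translation θ (w + z)).toContinuousLinearEquiv : L2 →L[ℂ] L2)) h5
    exact DFunLike.congr_fun this v

/-! ### Differentiability of the translations -/

lemma generator_real_mul (θ : ℝ) (w : ℂ) (t : ℝ) :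
    generator θ (t * w) = (t : ℂ) • generator θ w := by
  simp only [generator, map_mul, Complex.conj_ofReal]
  module

lemma generatorPowKet_real_mul (θ : ℝ) (w : ℂ) (t : ℝ) (k n : ℕ) :
    generatorPowKet θ (t * w) k n = t ^ k • generatorPowKet θ w k n := by
  apply lp.ext
  simp only [generatorPowKet, generator_real_mul, smul_pow, lp.coeFn_smul, LinearMap.smul_apply]
  norm_cast

lemma generatorPowKet_succ (θ : ℝ) (w : ℂ) (k n : ℕ) :
    generatorPowKet θ w (k + 1) n =
      scale θ • (w • (Real.sqrt (n + 1) : ℂ) • generatorPowKet θ w k (n + 1) -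
        (starRingEnd ℂ w) • (Real.sqrt n : ℂ) • generatorPowKet θ w k (n - 1)) := by
  apply lp.ext
  simp only [lp.coeFn_smul, lp.coeFn_sub, generatorPowKet, pow_succ, Module.End.mul_apply,
    generator_apply, creation_single, annihilation_single]
  simp only [map_smul, map_sub]

/-- The derivative of `exp(tA)|n⟩` is `exp(tA) A|n⟩`. -/
lemma hasDerivAt_expKet (θ : ℝ) (w : ℂ) (n : ℕ) (t : ℝ) :
    HasDerivAt (fun t : ℝ => expKet θ (t * w) n)
      (scale θ • (w • (Real.sqrt (n + 1) : ℂ) • expKet θ (t * w) (n + 1) -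
        (starRingEnd ℂ w) • (Real.sqrt n : ℂ) • expKet θ (t * w) (n - 1))) t := by
  -- The ball of radius R contains t. On it the differentiated series is dominated by the original
  -- one at R + 1, since k Rᵏ⁻¹ ≤ (R + 1)ᵏ.
  set R : ℝ := |t| + 1 with hR
  have hR0 : 0 < R := by positivity
  set g : ℕ → ℝ → L2 := fun k s => ((k.factorial : ℂ)⁻¹) • s ^ k • generatorPowKet θ w k n with hg
  set g' : ℕ → ℝ → L2 := fun k s =>
    ((k.factorial : ℂ)⁻¹) • (k * s ^ (k - 1)) • generatorPowKet θ w k n with hg'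
  have hexp : ∀ s : ℝ, expKet θ (s * w) n = ∑' k, g k s := fun s => by
    simp only [expKet, hg, generatorPowKet_real_mul]
  have hsum : ∀ s : ℝ, Summable fun k => ‖g k s‖ := fun s => by
    have := summable_norm_expKet θ (s * w) n
    simpa only [generatorPowKet_real_mul] using this
  have hbern : ∀ k : ℕ, k * R ^ (k - 1) ≤ (R + 1) ^ k := by
    intro k
    rcases k with _ | k
    · simp
    -- One term of the binomial expansion of (R + 1)ᵏ⁺¹ is (k + 1)Rᵏ.
    · have h := Finset.single_le_sum (f := fun m => R ^ m * 1 ^ (k + 1 - m) * ((k + 1).choose m : ℝ))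
        (s := Finset.range (k + 1 + 1)) (fun m _ => by positivity) (a := k)
        (Finset.mem_range.2 (by omega))
      rw [← add_pow] at h
      refine le_trans (le_of_eq ?_) h
      simp [mul_comm]
  have hd := hasDerivAt_tsum_of_isPreconnected (hsum (R + 1)) (Metric.isOpen_ball (x := (0 : ℝ)) (ε := R))
    (convex_ball (0 : ℝ) R).isPreconnected (g := g) (g' := g') (y₀ := 0) (y := t)
    (fun k s _ => ((hasDerivAt_pow k s).smul_const _).const_smul ((k.factorial : ℂ)⁻¹))
    (fun k s hs => by
      rw [mem_ball_zero_iff, Real.norm_eq_abs] at hs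
      simp only [hg, hg', norm_smul]
      gcongr
      rw [norm_mul, norm_pow, Real.norm_natCast, Real.norm_eq_abs, norm_pow, Real.norm_eq_abs,
        abs_of_pos (by positivity : 0 < R + 1)]
      refine le_trans ?_ (hbern k)
      gcongr) (by simpa using hR0) (hsum 0).of_norm (by simp [hR])
  simp only [hexp]
  refine hd.congr_deriv ?_
  have hs1 := (summable_norm_expKet θ (t * w) (n + 1)).of_norm.hasSum
  have hs2 := (summable_norm_expKet θ (t * w) (n - 1)).of_norm.hasSum
  have hs := ((((hs1.const_smul (Real.sqrt (n + 1) : ℂ)).const_smul w).sub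
    ((hs2.const_smul (Real.sqrt n : ℂ)).const_smul (starRingEnd ℂ w))).const_smul (scale θ))
  refine HasSum.tsum_eq ?_
  rw [← hasSum_nat_add_iff' 1]
  have h0 : ∑ i ∈ Finset.range 1, g' i t = 0 := by simp [hg']
  rw [h0, sub_zero]
  refine hs.congr_fun fun k => ?_
  have hk : (((k + 1).factorial : ℂ)⁻¹) * ((k : ℂ) + 1) = (k.factorial : ℂ)⁻¹ := by
    have h1 : (k.factorial : ℂ) ≠ 0 := Nat.cast_ne_zero.2 k.factorial_ne_zero
    have h2 : (k : ℂ) + 1 ≠ 0 := Nat.cast_add_one_ne_zero k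
    rw [Nat.factorial_succ]
    push_cast
    field_simp
  have e : ∀ {V : Type} [AddCommGroup V] [Module ℂ V] [Module ℝ V] [IsScalarTower ℝ ℂ V]
      (a b p q r s : ℂ) (τ : ℝ) (x y : V), a * ((k : ℂ) + 1) = b →
      a • (((k + 1 : ℕ) : ℝ) * τ) • s • (w • p • x - q • r • y) =
        s • (w • p • b • τ • x - q • r • b • τ • y) := by
    intro V _ _ _ _ a b p q r s τ x y h
    subst h
    have hτ : ∀ (τ : ℝ) (x : V), τ • x = (τ : ℂ) • x := fun τ x => by
      rw [← smul_one_smul ℂ τ x]; simp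
    simp only [hτ]
    push_cast
    module
  simp only [hg', Nat.add_sub_cancel, generatorPowKet_succ, generatorPowKet_real_mul]
  exact e _ _ _ _ _ _ _ _ _ hk

/-- Finite linear combinations of the basis vectors are in the domain of the ladder operators and
are differentiable vectors of the translations. -/
lemma exists_ladder_of_mem_span (θ : ℝ) {u : L2} (hu : u ∈ Submodule.span ℂ (Set.range ket)) :
    ∃ ua uc : L2, annihilation u = ua ∧ creation u = uc ∧ ∀ (w : ℂ) (t : ℝ),
      HasDerivAt (fun t : ℝ => translation θ (t * w) u)
        (translation θ (t * w) (scale θ • (w • uc - (starRingEnd ℂ w) • ua))) t := by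
  induction hu using Submodule.span_induction with
  | mem u hu =>
    obtain ⟨n, rfl⟩ := hu
    refine ⟨_, _, annihilation_ket n, creation_ket n, fun w t => ?_⟩
    simpa only [map_smul, map_sub, translation_ket] using hasDerivAt_expKet θ w n t
  | zero =>
    refine ⟨0, 0, by rw [lp.coeFn_zero, map_zero], by rw [lp.coeFn_zero, map_zero], fun w t => ?_⟩
    simpa using hasDerivAt_const t (0 : L2)
  | add u v _ _ hu hv =>
    obtain ⟨ua, uc, h1, h2, h3⟩ := hu
    obtain ⟨va, vc, k1, k2, k3⟩ := hv
    refine ⟨ua + va, uc + vc, by rw [lp.coeFn_add, map_add, h1, k1, lp.coeFn_add],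
      by rw [lp.coeFn_add, map_add, h2, k2, lp.coeFn_add], fun w t => ?_⟩
    have h := (h3 w t).add (k3 w t)
    simp only [map_add]
    refine h.congr_deriv ?_
    rw [← map_add]
    congr 1
    simp only [smul_add, smul_sub]
    abel
  | smul c u _ hu =>
    obtain ⟨ua, uc, h1, h2, h3⟩ := hu
    refine ⟨c • ua, c • uc, by rw [lp.coeFn_smul, map_smul, h1, lp.coeFn_smul],
      by rw [lp.coeFn_smul, map_smul, h2, lp.coeFn_smul], fun w t => ?_⟩
    have h := (h3 w t).const_smul c
    simp only [map_smul]
    refine h.congr_deriv ?_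
    simp only [map_smul, map_sub, smul_sub, smul_comm c]

lemma dense_span_ket : Dense (Submodule.span ℂ (Set.range ket) : Set L2) := by
  intro v
  refine mem_closure_of_tendsto (hasSum_ket v) (Filter.Eventually.of_forall fun s => ?_)
  exact Submodule.sum_mem _ fun i _ =>
    Submodule.smul_mem _ _ (Submodule.subset_span (Set.mem_range_self i))

/-! ### The spectral distance is at most the length of the translation -/

lemma toLp_mem_diracDomain {u ua uc v va vc : L2} (hua : annihilation u = ua)
    (huc : creation u = uc) (hva : annihilation v = va) (hvc : creation v = vc) :
    WithLp.toLp 2 (u, v) ∈ diracDomain :=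
  have h : ∀ {x : ℕ → ℂ} {y : L2}, x = y → Memℓp x 2 := fun e => e ▸ lp.memℓp _
  ⟨⟨h hua, h huc⟩, h hva, h hvc⟩

lemma dirac_toLp (θ : ℝ) {u uc v va : L2} (huc : creation u = uc) (hva : annihilation v = va)
    (h : WithLp.toLp 2 (u, v) ∈ diracDomain) :
    dirac θ ⟨WithLp.toLp 2 (u, v), h⟩ = (Real.sqrt (2 / θ) : ℂ) • WithLp.toLp 2 (va, uc) := by
  change (Real.sqrt (2 / θ) : ℂ) • WithLp.toLp 2
    ((⟨annihilation v, h.2.1⟩ : L2), (⟨creation u, h.1.2⟩ : L2)) = _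
  rw [show (⟨annihilation v, h.2.1⟩ : L2) = va from lp.ext hva,
    show (⟨creation u, h.1.2⟩ : L2) = uc from lp.ext huc]

/-- D is off-diagonal, so evaluating [D, f] on (0, v) and (v, 0) isolates x = [𝔞, f]v and y = [𝔞†,
f]v. The factor √(θ/2) undoes the normalisation √(2/θ) of D. -/
lemma exists_ladder_commutator {θ : ℝ} (hθ : 0 < θ) {f : L2 →L[ℂ] L2}
    {C : DoubledL2 →L[ℂ] DoubledL2} (hC : SpectralTriple.IsCommutator (dirac θ) (doubled f) C)
    (hC1 : ‖C‖ ≤ 1) {v va vc : L2} (ha : annihilation v = va) (hc : creation v = vc) :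
    ∃ x y : L2, annihilation (f v) = ⇑(f va + x) ∧ creation (f v) = ⇑(f vc + y) ∧
      ‖x‖ ≤ Real.sqrt (θ / 2) * ‖v‖ ∧ ‖y‖ ≤ Real.sqrt (θ / 2) * ‖v‖ := by
  have hs : 0 < Real.sqrt (2 / θ) := Real.sqrt_pos.2 (by positivity)
  have hs' : Real.sqrt (θ / 2) = (Real.sqrt (2 / θ))⁻¹ := by
    rw [← Real.sqrt_inv, inv_div]
  have hs0 : (Real.sqrt (2 / θ) : ℂ) ≠ 0 := Complex.ofReal_ne_zero.2 hs.ne'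
  have z1 : annihilation ⇑(0 : L2) = ⇑(0 : L2) := by rw [lp.coeFn_zero, map_zero]
  have z2 : creation ⇑(0 : L2) = ⇑(0 : L2) := by rw [lp.coeFn_zero, map_zero]
  have h1 := toLp_mem_diracDomain ha hc z1 z2
  have h2 := toLp_mem_diracDomain z1 z2 ha hc
  obtain ⟨m1, e1⟩ := hC ⟨_, h1⟩
  obtain ⟨m2, e2⟩ := hC ⟨_, h2⟩
  have hle : ∀ u : DoubledL2, ‖C u‖ ≤ ‖u‖ := fun u =>
    (C.le_opNorm u).trans (mul_le_of_le_one_left (norm_nonneg _) hC1)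
  refine ⟨(Real.sqrt (2 / θ) : ℂ)⁻¹ • (C (WithLp.toLp 2 ((0 : L2), v))).fst,
    (Real.sqrt (2 / θ) : ℂ)⁻¹ • (C (WithLp.toLp 2 (v, (0 : L2)))).snd, ?_, ?_, ?_, ?_⟩
  · rw [dirac_toLp θ z2 ha] at e2
    have e3 : (Real.sqrt (2 / θ) : ℂ) • annihilation (f v) -
        ⇑(f ((Real.sqrt (2 / θ) : ℂ) • va)) = ⇑(C (WithLp.toLp 2 ((0 : L2), v))).fst :=
      congrArg (fun u : DoubledL2 => ⇑u.fst) e2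
    rw [lp.coeFn_add, lp.coeFn_smul, ← e3, map_smul, lp.coeFn_smul, smul_sub,
      inv_smul_smul₀ hs0, inv_smul_smul₀ hs0, add_sub_cancel]
  · rw [dirac_toLp θ hc z1] at e1
    have e3 : (Real.sqrt (2 / θ) : ℂ) • creation (f v) -
        ⇑(f ((Real.sqrt (2 / θ) : ℂ) • vc)) = ⇑(C (WithLp.toLp 2 (v, (0 : L2)))).snd :=
      congrArg (fun u : DoubledL2 => ⇑u.snd) e1
    rw [lp.coeFn_add, lp.coeFn_smul, ← e3, map_smul, lp.coeFn_smul, smul_sub,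
      inv_smul_smul₀ hs0, inv_smul_smul₀ hs0, add_sub_cancel]
  · rw [norm_smul, norm_inv, Complex.norm_real, Real.norm_of_nonneg hs.le, ← hs']
    gcongr
    refine (WithLp.norm_fst_le _ _).trans ((hle _).trans_eq ?_)
    simp
  · rw [norm_smul, norm_inv, Complex.norm_real, Real.norm_of_nonneg hs.le, ← hs']
    gcongr
    refine (WithLp.norm_snd_le _ _).trans ((hle _).trans_eq ?_)
    simp

/-- Mean value inequality along t ↦ T(tw)u, whose velocity turns the derivative of the expectation
into commutators of f with the ladder operators. -/
lemma norm_expectation_translation_sub_le {θ : ℝ} (hθ : 0 < θ) {f : L2 →L[ℂ] L2}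
    {C : DoubledL2 →L[ℂ] DoubledL2} (hC : SpectralTriple.IsCommutator (dirac θ) (doubled f) C)
    (hC1 : ‖C‖ ≤ 1) (w : ℂ) (u : L2) :
    ‖inner ℂ (translation θ w u) (f (translation θ w u)) - inner ℂ u (f u)‖ ≤ ‖w‖ * ‖u‖ ^ 2 := by
  -- Both sides are continuous in u because f is bounded, so finite vectors suffice.
  have hclosed : IsClosed {u : L2 | ‖inner ℂ (translation θ w u) (f (translation θ w u)) -
      inner ℂ u (f u)‖ ≤ ‖w‖ * ‖u‖ ^ 2} := by
    refine isClosed_le ?_ ?_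
    · have := (translation θ w).continuous
      fun_prop
    · fun_prop
  refine hclosed.closure_subset_iff.2 ?_ (dense_span_ket u)
  intro u hu
  obtain ⟨ua, uc, ha, hc, hd⟩ := exists_ladder_of_mem_span θ hu
  have h0 : ∀ v, translation θ 0 v = v := by
    intro v
    have h := continuousLinearMap_ext_ket
      (S := ((translation θ 0).toContinuousLinearEquiv : L2 →L[ℂ] L2))
      (T := ContinuousLinearMap.id ℂ L2) (fun n => ?_)
    · exact DFunLike.congr_fun h v
    · change translation θ 0 (ket n) = ket n
      rw [translation_ket, expKet]
      have h1 : ∀ k, generatorPowKet θ 0 k n = (0 : ℝ) ^ k • generatorPowKet θ 0 k n := fun k => by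
        rw [← generatorPowKet_real_mul, Complex.ofReal_zero, zero_mul]
      rw [tsum_eq_single 0 fun k hk => by rw [h1, zero_pow hk, zero_smul, smul_zero]]
      apply lp.ext
      simp [generatorPowKet, coe_ket]
  have hmv := norm_image_sub_le_of_norm_deriv_le_segment_01'
    (f := fun t : ℝ => inner ℂ (translation θ (t * w) u) (f (translation θ (t * w) u)))
    (C := ‖w‖ * ‖u‖ ^ 2)
    (fun t _ => ((hd w t).inner ℂ
      ((f.restrictScalars ℝ).hasFDerivAt.comp_hasDerivAt t (hd w t))).hasDerivWithinAt)
    (fun t _ => ?_)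
  · simpa [h0] using hmv
  · set v := translation θ (t * w) u with hv
    have hva := annihilation_translation θ (t * w) ha
    have hvc := creation_translation θ (t * w) hc
    rw [← hv] at hva hvc
    set va := translation θ (t * w) ua + (t * w * scale θ) • v with hva'
    set vc := translation θ (t * w) uc + ((starRingEnd ℂ) (t * w) * scale θ) • v with hvc'
    -- The scalar shifts of 𝔞 and 𝔞† cancel in w𝔞† - w̄𝔞, which expresses that T(tw) commutes with
    -- its own generator.
    have hg : translation θ (t * w) (scale θ • (w • uc - (starRingEnd ℂ) w • ua)) =
        scale θ • (w • vc - (starRingEnd ℂ) w • va) := by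
      simp only [hva', hvc', map_smul, map_sub, smul_add, map_mul, Complex.conj_ofReal]
      rw [show w • ((t : ℂ) * (starRingEnd ℂ) w * scale θ) • v =
        (starRingEnd ℂ) w • ((t : ℂ) * w * scale θ) • v by
          rw [smul_smul, smul_smul]; congr 1; ring, add_sub_add_right_eq_sub]
    obtain ⟨x, y, hx, hy, hxn, hyn⟩ := exists_ladder_commutator hθ hC hC1 hva hvc
    have i1 := inner_creation_left hvc hx
    have i2 := congrArg (starRingEnd ℂ) (inner_creation_left hy hva)
    rw [inner_conj_symm, inner_conj_symm] at i2
    -- The terms in f va and f vc cancel by adjointness; only the commutators x and y remain.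
    have hF : inner ℂ v (f (scale θ • (w • vc - (starRingEnd ℂ) w • va))) +
        inner ℂ (scale θ • (w • vc - (starRingEnd ℂ) w • va)) (f v) =
        scale θ * ((starRingEnd ℂ) w * inner ℂ v x - w * inner ℂ v y) := by
      simp only [map_smul, map_sub, inner_smul_right, inner_smul_left, inner_sub_left,
        inner_sub_right, conj_scale, Complex.conj_conj, i1, ← i2, inner_add_right]
      ring
    have hvn : ‖v‖ = ‖u‖ := (translation θ (t * w)).norm_map u
    rw [hg]
    change ‖inner ℂ v (f (scale θ • (w • vc - (starRingEnd ℂ) w • va))) +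
        inner ℂ (scale θ • (w • vc - (starRingEnd ℂ) w • va)) (f v)‖ ≤ _
    rw [hF, norm_mul]
    -- The normalisations of T and D match exactly here: this gives the constant 1 in the distance.
    have hsc : ‖scale θ‖ * (2 * Real.sqrt (θ / 2)) = 1 := by
      rw [scale, Complex.norm_real, Real.norm_of_nonneg (by positivity),
        show 2 * θ = 2 ^ 2 * (θ / 2) by ring, Real.sqrt_mul (by positivity),
        Real.sqrt_sq (by positivity)]
      have : Real.sqrt (θ / 2) ≠ 0 := (Real.sqrt_pos.2 (by positivity)).ne'
      field_simp
    have b1 : ‖(inner ℂ v x : ℂ)‖ ≤ ‖v‖ * (Real.sqrt (θ / 2) * ‖v‖) :=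
      (norm_inner_le_norm _ _).trans (by gcongr)
    have b2 : ‖(inner ℂ v y : ℂ)‖ ≤ ‖v‖ * (Real.sqrt (θ / 2) * ‖v‖) :=
      (norm_inner_le_norm _ _).trans (by gcongr)
    calc ‖scale θ‖ * ‖(starRingEnd ℂ) w * inner ℂ v x - w * inner ℂ v y‖
        ≤ ‖scale θ‖ * (‖w‖ * (‖v‖ * (Real.sqrt (θ / 2) * ‖v‖)) +
            ‖w‖ * (‖v‖ * (Real.sqrt (θ / 2) * ‖v‖))) := by
          gcongr
          refine (norm_sub_le _ _).trans ?_
          rw [norm_mul, norm_mul, RCLike.norm_conj]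
          gcongr
      _ = (‖scale θ‖ * (2 * Real.sqrt (θ / 2))) * (‖w‖ * ‖v‖ ^ 2) := by ring
      _ = ‖w‖ * ‖u‖ ^ 2 := by rw [hsc, one_mul, hvn]

/-- The difference of the expectations of `f` in two translates of `ψ` is at most `|z - z'|`. -/
lemma norm_expectation_sub_le {θ : ℝ} (hθ : 0 < θ) {f : L2 →L[ℂ] L2}
    {C : DoubledL2 →L[ℂ] DoubledL2} (hC : SpectralTriple.IsCommutator (dirac θ) (doubled f) C)
    (hC1 : ‖C‖ ≤ 1) (z z' : ℂ) (ψ : L2) :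
    ‖inner ℂ (translation θ z ψ) (f (translation θ z ψ)) -
      inner ℂ (translation θ z' ψ) (f (translation θ z' ψ))‖ ≤ ‖z - z'‖ * ‖ψ‖ ^ 2 := by
  -- The phase c drops out of the expectation.
  obtain ⟨c, hc, h⟩ := translation_translation θ (z - z') z'
  have := norm_expectation_translation_sub_le hθ hC hC1 (z - z') (translation θ z' ψ)
  rw [h, sub_add_cancel, map_smul, inner_smul_left, inner_smul_right, ← mul_assoc,
    Complex.conj_mul', hc, LinearIsometryEquiv.norm_map] at this
  simpa using this

/-! ### Weighted composition operators -/

lemma norm_sq_eq_tsum (v : L2) : ‖v‖ ^ 2 = ∑' n, ‖v n‖ ^ 2 := by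
  simpa using lp.norm_rpow_eq_tsum (p := 2) (by norm_num) v

lemma summable_norm_sq (v : L2) : Summable fun n => ‖v n‖ ^ 2 := by
  simpa using (lp.memℓp v).summable (by norm_num)

/-- Restricted to the support of d, the values |v(τ n)|² are distinct terms of the norm series of v.
Injectivity is required only there, so that truncated subtraction is allowed as τ. -/
lemma summable_weighted_comp {d v : ℕ → ℂ} {τ : ℕ → ℕ} {M : ℝ} (hd : ∀ n, ‖d n‖ ≤ M)
    (hτ : Set.InjOn τ {n | d n ≠ 0}) (hv : Summable fun n => ‖v n‖ ^ 2) :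
    Summable (fun n => ‖d n * v (τ n)‖ ^ 2) ∧
      ∑' n, ‖d n * v (τ n)‖ ^ 2 ≤ M ^ 2 * ∑' n, ‖v n‖ ^ 2 := by
  set s : Set ℕ := {n | d n ≠ 0} with hs
  have hsup : Function.support (fun n => ‖d n * v (τ n)‖ ^ 2) ⊆ s := by
    intro n hn h
    exact hn (by simp [h])
  have hinj : Function.Injective fun n : s => τ n := hτ.injective
  have h1 : Summable fun n : s => M ^ 2 * ‖v (τ n)‖ ^ 2 :=
    (hv.comp_injective hinj).mul_left (M ^ 2)
  have hle : ∀ n : s, ‖d n * v (τ n)‖ ^ 2 ≤ M ^ 2 * ‖v (τ n)‖ ^ 2 := by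
    intro n
    rw [norm_mul, mul_pow]
    gcongr
    exact hd n
  have h2 : Summable fun n : s => ‖d n * v (τ n)‖ ^ 2 :=
    h1.of_nonneg_of_le (fun _ => sq_nonneg _) hle
  refine ⟨?_, ?_⟩
  · have h3 := (summable_subtype_iff_indicator (f := fun n => ‖d n * v (τ n)‖ ^ 2)).1 h2
    rwa [Set.indicator_eq_self.2 hsup] at h3
  · rw [← tsum_subtype_eq_of_support_subset hsup, ← tsum_mul_left]
    refine (h2.tsum_le_tsum hle h1).trans ?_
    exact h1.tsum_le_tsum_of_inj _ hinj (fun _ _ => by positivity) (fun _ => le_rfl)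
      (hv.mul_left (M ^ 2))

/-- The operator `(W v)ₙ = dₙ v_{τ n}`, for bounded weights `d` on whose support `τ` is
injective. -/
def weightedComp (d : ℕ → ℂ) (τ : ℕ → ℕ) (M : ℝ) (hd : ∀ n, ‖d n‖ ≤ M)
    (hτ : Set.InjOn τ {n | d n ≠ 0}) : L2 →L[ℂ] L2 :=
  LinearMap.mkContinuous
    { toFun := fun v => ⟨fun n => d n * v (τ n), memℓp_gen <| by
        simpa using (summable_weighted_comp hd hτ (summable_norm_sq v)).1⟩
      map_add' := fun u v => lp.ext <| by
        ext n
        simp only [lp.coeFn_add, Pi.add_apply, mul_add]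
      map_smul' := fun c v => lp.ext <| by
        ext n
        simp only [lp.coeFn_smul, Pi.smul_apply, smul_eq_mul, RingHom.id_apply, mul_left_comm] }
    M fun v => by
      have hM : 0 ≤ M := (norm_nonneg _).trans (hd 0)
      refine le_of_sq_le_sq ?_ (by positivity)
      rw [norm_sq_eq_tsum, mul_pow, norm_sq_eq_tsum v]
      exact (summable_weighted_comp hd hτ (summable_norm_sq v)).2

lemma norm_weightedComp_le {d : ℕ → ℂ} {τ : ℕ → ℕ} {M : ℝ} (hd : ∀ n, ‖d n‖ ≤ M)
    (hτ : Set.InjOn τ {n | d n ≠ 0}) : ‖weightedComp d τ M hd hτ‖ ≤ M :=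
  LinearMap.mkContinuous_norm_le _ ((norm_nonneg _).trans (hd 0)) _

lemma injOn_pred {d : ℕ → ℂ} {k : ℕ} (hd : ∀ n < k, d n = 0) :
    Set.InjOn (fun n => n - k) {n | d n ≠ 0} := by
  intro m hm n hn h
  have h1 : k ≤ m := not_lt.1 fun h => hm (hd m h)
  have h2 : k ≤ n := not_lt.1 fun h => hn (hd n h)
  simp only at h
  omega

/-! ### Logarithmic cut-offs -/

/-- A slowly decaying cut-off of finite support. -/
def cutoff (ε : ℝ) (n : ℕ) : ℝ := max 0 (1 - ε * Real.log (n + 1))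

lemma cutoff_nonneg (ε : ℝ) (n : ℕ) : 0 ≤ cutoff ε n := le_max_left _ _

lemma cutoff_le_one {ε : ℝ} (hε : 0 ≤ ε) (n : ℕ) : cutoff ε n ≤ 1 := by
  refine max_le zero_le_one ?_
  have : 0 ≤ Real.log (n + 1) := Real.log_nonneg (by simp)
  nlinarith

/-- The logarithm has increments at most 1/(n+1), exactly what the growth of 𝔞𝔞† can absorb. A
linear cut-off on [0, N] would leave an error of order 1. -/
lemma abs_cutoff_succ_sub {ε : ℝ} (hε : 0 ≤ ε) (n : ℕ) :
    (n + 1) * |cutoff ε (n + 1) - cutoff ε n| ≤ ε := by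
  have h1 : |cutoff ε (n + 1) - cutoff ε n| ≤
      |(1 - ε * Real.log ((n + 1 : ℕ) + 1)) - (1 - ε * Real.log (n + 1))| := by
    refine (abs_max_sub_max_le_max _ _ _ _).trans ?_
    simp
  have hn : (0 : ℝ) < (n : ℝ) + 1 := by positivity
  have h2 : Real.log ((n + 1 : ℕ) + 1) - Real.log (n + 1) ≤ 1 / ((n : ℝ) + 1) := by
    rw [← Real.log_div (by positivity) hn.ne']
    refine (Real.log_le_sub_one_of_pos (by positivity)).trans_eq ?_
    push_cast
    field_simp
    ring
  have h3 : 0 ≤ Real.log ((n + 1 : ℕ) + 1) - Real.log (n + 1) := by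
    refine sub_nonneg.2 (Real.log_le_log hn ?_)
    push_cast
    linarith
  rw [show (1 - ε * Real.log ((n + 1 : ℕ) + 1)) - (1 - ε * Real.log (n + 1)) =
    -(ε * (Real.log ((n + 1 : ℕ) + 1) - Real.log (n + 1))) by ring, abs_neg, abs_mul,
    abs_of_nonneg hε, abs_of_nonneg h3] at h1
  calc (n + 1) * |cutoff ε (n + 1) - cutoff ε n|
      ≤ (n + 1) * (ε * (1 / ((n : ℝ) + 1))) := by gcongr; exact h1.trans (by gcongr)
    _ = ε := by field_simp

lemma exists_cutoff_eq_zero {ε : ℝ} (hε : 0 < ε) : ∃ N, ∀ n ≥ N, cutoff ε n = 0 := by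
  have h : Filter.Tendsto (fun n : ℕ => Real.log ((n : ℝ) + 1)) Filter.atTop Filter.atTop :=
    Real.tendsto_log_atTop.comp
      (Filter.tendsto_atTop_add_const_right _ _ tendsto_natCast_atTop_atTop)
  obtain ⟨N, hN⟩ := Filter.eventually_atTop.1 (h.eventually_ge_atTop (1 / ε))
  refine ⟨N, fun n hn => max_eq_left ?_⟩
  have := hN n hn
  rw [div_le_iff₀ hε] at this
  linarith

lemma tendsto_cutoff (n : ℕ) :
    Filter.Tendsto (fun ε => cutoff ε n) (nhdsWithin 0 (Set.Ioi 0)) (nhds 1) := by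
  have h : Continuous fun ε => cutoff ε n := by unfold cutoff; fun_prop
  have := (h.tendsto 0).mono_left (nhdsWithin_le_nhds (s := Set.Ioi 0))
  simpa [cutoff] using this

/-! ### Test operators -/

/-- The lowering weights of `𝔞 cutoff(N)`. -/
def ladderWeight (ε : ℝ) (n : ℕ) : ℝ := Real.sqrt n * cutoff ε n

lemma exists_norm_ladderWeight_le {ε : ℝ} (hε : 0 < ε) (μ : ℂ) :
    ∃ M, ∀ n, ‖μ * ladderWeight ε n‖ ≤ M := by
  obtain ⟨N, hN⟩ := exists_cutoff_eq_zero hε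
  refine ⟨‖μ‖ * Real.sqrt N, fun n => ?_⟩
  rw [norm_mul, Complex.norm_real, ladderWeight, norm_mul, Real.norm_of_nonneg (Real.sqrt_nonneg _),
    Real.norm_of_nonneg (cutoff_nonneg _ _)]
  gcongr
  rcases le_total N n with h | h
  · rw [hN n h]; simp
  · calc Real.sqrt n * cutoff ε n ≤ Real.sqrt N * 1 := by
          gcongr
          · exact cutoff_nonneg _ _
          · exact cutoff_le_one hε.le n
      _ = _ := mul_one _

lemma exists_testOperator {ε : ℝ} (hε : 0 < ε) (μ : ℂ) : ∃ f : L2 →L[ℂ] L2, ∀ v n,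
    f v n = μ * ladderWeight ε (n + 1) * v (n + 1) +
      starRingEnd ℂ μ * ladderWeight ε n * v (n - 1) := by
  obtain ⟨M, hM⟩ := exists_norm_ladderWeight_le hε μ
  obtain ⟨M', hM'⟩ := exists_norm_ladderWeight_le hε (starRingEnd ℂ μ)
  refine ⟨weightedComp (fun n => μ * ladderWeight ε (n + 1)) (fun n => n + 1) M (fun n => hM _)
    (add_left_injective 1).injOn + weightedComp (fun n => starRingEnd ℂ μ * ladderWeight ε n)
      (fun n => n - 1) M' hM' (injOn_pred fun n hn => ?_), fun v n => ?_⟩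
  · obtain rfl : n = 0 := by omega
    simp [ladderWeight]
  · rfl

/-- The truncation `μ 𝔞 + μ̄ 𝔞†`, with a logarithmic cut-off. -/
def testOperator {ε : ℝ} (hε : 0 < ε) (μ : ℂ) : L2 →L[ℂ] L2 := (exists_testOperator hε μ).choose

section TestOperator

variable {ε : ℝ} (hε : 0 < ε) (μ : ℂ)

lemma testOperator_apply (v : L2) (n : ℕ) :
    testOperator hε μ v n = μ * ladderWeight ε (n + 1) * v (n + 1) +
      starRingEnd ℂ μ * ladderWeight ε n * v (n - 1) :=
  (exists_testOperator hε μ).choose_spec v n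

lemma entry_testOperator (m n : ℕ) : entry (testOperator hε μ) m n =
    if n = m + 1 then μ * ladderWeight ε n
    else if m = n + 1 then starRingEnd ℂ μ * ladderWeight ε m else 0 := by
  rw [entry_eq, testOperator_apply, coe_ket]
  by_cases h1 : n = m + 1
  · subst h1
    rcases m with _ | m
    · simp [ladderWeight]
    · simp [show m ≠ m + 1 + 1 by omega]
  · by_cases h2 : m = n + 1
    · subst h2
      simp [h1]
    · rcases m with _ | m
      · simp [h1, ladderWeight, Ne.symm h1]
      · have h3 : m ≠ n := by omega
        simp [h1, Ne.symm h1, h3]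

lemma rapidDecay_testOperator : RapidDecay (entry (testOperator hε μ)) := by
  intro k
  obtain ⟨N, hN⟩ := exists_cutoff_eq_zero hε
  refine ⟨∑ p ∈ Finset.range N ×ˢ Finset.range N,
    ((p.1 : ℝ) + 1) ^ k * ((p.2 : ℝ) + 1) ^ k * ‖entry (testOperator hε μ) p.1 p.2‖, fun m n => ?_⟩
  by_cases h : m < N ∧ n < N
  · exact Finset.single_le_sum (f := fun p : ℕ × ℕ => ((p.1 : ℝ) + 1) ^ k * ((p.2 : ℝ) + 1) ^ k *
      ‖entry (testOperator hε μ) p.1 p.2‖) (fun _ _ => by positivity) (a := (m, n)) (by simp [h])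
  · have h0 : entry (testOperator hε μ) m n = 0 := by
      rw [entry_testOperator]
      split_ifs with h1 h2
      · rw [ladderWeight, hN n (by omega)]; simp
      · rw [ladderWeight, hN m (by omega)]; simp
      · rfl
    rw [h0, norm_zero, mul_zero]
    positivity

lemma isSelfAdjoint_testOperator : IsSelfAdjoint (testOperator hε μ) := by
  refine continuousLinearMap_ext_ket fun n => lp.ext (funext fun m => ?_)
  rw [← entry_eq, ← entry_eq, entry_star, entry_testOperator, entry_testOperator]
  by_cases h1 : n = m + 1
  · simp [h1, show m ≠ m + 1 + 1 by omega]
  · by_cases h2 : m = n + 1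
    · simp [h2, show n ≠ n + 1 + 1 by omega]
    · simp [h1, h2]

/-- The cut-off sits at n + 1 in the lowering part and at n in the raising part. -/
lemma testOperator_eq_of_ladder {v va vc : L2} (ha : annihilation v = va) (hc : creation v = vc)
    (n : ℕ) : testOperator hε μ v n =
      μ * cutoff ε (n + 1) * va n + starRingEnd ℂ μ * cutoff ε n * vc n := by
  rw [testOperator_apply, ← ha, ← hc]
  simp only [ladderWeight, annihilation, creation, LinearMap.coe_mk, AddHom.coe_mk]
  push_cast
  ring

/-! ### Commutators of the test operator with the ladder operators -/

lemma sqrt_mul_sqrt_mul_abs_cutoff_le {ε : ℝ} (hε : 0 < ε) (n : ℕ) :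
    Real.sqrt n * Real.sqrt (n + 1) * |cutoff ε (n + 1) - cutoff ε n| ≤ ε := by
  refine le_trans ?_ (abs_cutoff_succ_sub hε.le n)
  gcongr
  calc Real.sqrt n * Real.sqrt (n + 1) ≤ Real.sqrt (n + 1) * Real.sqrt (n + 1) := by
        gcongr; linarith
    _ = n + 1 := Real.mul_self_sqrt (by positivity)

/-- Discrete product rule: the scalar commutator 1 appears damped by the cut-off, plus an error of
size ε. -/
lemma abs_cutoff_succ_mul_sub_le {ε : ℝ} (hε : 0 < ε) (n : ℕ) :
    |((n : ℝ) + 1) * cutoff ε (n + 1) - n * cutoff ε n| ≤ 1 + ε := by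
  have h1 := abs_cutoff_succ_sub hε.le n
  rw [show ((n : ℝ) + 1) * cutoff ε (n + 1) - n * cutoff ε n =
    cutoff ε n + (n + 1) * (cutoff ε (n + 1) - cutoff ε n) by ring]
  refine (abs_add_le _ _).trans (add_le_add ?_ ?_)
  · rw [abs_of_nonneg (cutoff_nonneg _ _)]
    exact cutoff_le_one hε.le n
  · rwa [abs_mul, abs_of_nonneg (by positivity : (0 : ℝ) ≤ (n : ℝ) + 1)]

lemma ofReal_sqrt_mul_self {x : ℝ} (hx : 0 ≤ x) : (Real.sqrt x : ℂ) * Real.sqrt x = x := by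
  rw [← Complex.ofReal_mul, Real.mul_self_sqrt hx]

/-- The commutator of the annihilation operator with the test operator. -/
lemma exists_annihilation_commutator : ∃ A : L2 →L[ℂ] L2, ‖A‖ ≤ ‖μ‖ * (1 + 2 * ε) ∧
    ∀ {v va : L2}, annihilation v = va →
      annihilation (testOperator hε μ v) = ⇑(testOperator hε μ va + A v) := by
  -- The commutator has two bands: n → n + 2, which only sees increments of the cut-off (`b1`), and
  -- the diagonal, a perturbed scalar (`b2`).
  have b1 : ∀ n : ℕ, ‖μ * ((Real.sqrt ((n + 1 : ℕ) : ℝ) * Real.sqrt ((n + 1 : ℕ) + 1) *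
      (cutoff ε (n + 1 + 1) - cutoff ε (n + 1)) : ℝ) : ℂ)‖ ≤ ‖μ‖ * ε := by
    intro n
    rw [norm_mul, Complex.norm_real, Real.norm_eq_abs, abs_mul, abs_of_nonneg (by positivity)]
    gcongr
    exact sqrt_mul_sqrt_mul_abs_cutoff_le hε (n + 1)
  have b2 : ∀ n : ℕ, ‖starRingEnd ℂ μ *
      ((((n : ℝ) + 1) * cutoff ε (n + 1) - n * cutoff ε n : ℝ) : ℂ)‖ ≤ ‖μ‖ * (1 + ε) := by
    intro n
    rw [norm_mul, Complex.norm_real, Real.norm_eq_abs, RCLike.norm_conj]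
    gcongr
    exact abs_cutoff_succ_mul_sub_le hε n
  refine ⟨weightedComp _ (fun n => n + 2) _ b1 (add_left_injective 2).injOn +
    weightedComp _ id _ b2 Function.injective_id.injOn, ?_, fun {v va} ha => ?_⟩
  · refine (norm_add_le _ _).trans ((add_le_add (norm_weightedComp_le _ _)
      (norm_weightedComp_le _ _)).trans_eq ?_)
    ring
  · ext n
    change (Real.sqrt (n + 1) : ℂ) * testOperator hε μ v (n + 1) = testOperator hε μ va n +
      (μ * ((Real.sqrt ((n + 1 : ℕ) : ℝ) * Real.sqrt ((n + 1 : ℕ) + 1) *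
      (cutoff ε (n + 1 + 1) - cutoff ε (n + 1)) : ℝ) : ℂ) * v (n + 2) + starRingEnd ℂ μ *
      ((((n : ℝ) + 1) * cutoff ε (n + 1) - n * cutoff ε n : ℝ) : ℂ) * v n)
    rw [testOperator_apply, testOperator_apply, ← ha]
    have e1 := ofReal_sqrt_mul_self (by positivity : (0 : ℝ) ≤ (n : ℝ) + 1)
    have e2 := ofReal_sqrt_mul_self (by positivity : (0 : ℝ) ≤ (n : ℝ))
    have e3 : (Real.sqrt n : ℂ) * annihilation v (n - 1) = n * v n := by
      rcases n with _ | n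
      · simp
      · simp only [annihilation, LinearMap.coe_mk, AddHom.coe_mk, Nat.add_sub_cancel, ← mul_assoc]
        push_cast at e2 ⊢
        rw [e2]
    have e4 : annihilation v (n + 1) = (Real.sqrt (n + 1 + 1) : ℂ) * v (n + 2) := by
      simp [annihilation]
    rw [e4]
    simp only [ladderWeight, Nat.add_sub_cancel]
    push_cast at e1 e2 e3 ⊢
    linear_combination (starRingEnd ℂ μ * cutoff ε (n + 1) * v n) * e1 -
      (starRingEnd ℂ μ * cutoff ε n) * e3

/-- The commutator of the creation operator with the test operator. -/
lemma exists_creation_commutator : ∃ A : L2 →L[ℂ] L2, ‖A‖ ≤ ‖μ‖ * (1 + 2 * ε) ∧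
    ∀ {v vc : L2}, creation v = vc →
      creation (testOperator hε μ v) = ⇑(testOperator hε μ vc + A v) := by
  have b1 : ∀ n : ℕ, ‖starRingEnd ℂ μ * ((Real.sqrt ((n - 1 : ℕ) : ℝ) * Real.sqrt (n : ℝ) *
      (cutoff ε (n - 1) - cutoff ε n) : ℝ) : ℂ)‖ ≤ ‖μ‖ * ε := by
    intro n
    rw [norm_mul, Complex.norm_real, Real.norm_eq_abs, abs_mul, abs_of_nonneg (by positivity),
      RCLike.norm_conj]
    gcongr
    rcases n with _ | n
    · simpa using hε.le
    · rw [abs_sub_comm]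
      simpa using sqrt_mul_sqrt_mul_abs_cutoff_le hε n
  have b2 : ∀ n : ℕ, ‖-μ *
      ((((n : ℝ) + 1) * cutoff ε (n + 1) - n * cutoff ε n : ℝ) : ℂ)‖ ≤ ‖μ‖ * (1 + ε) := by
    intro n
    rw [norm_mul, Complex.norm_real, Real.norm_eq_abs, norm_neg]
    gcongr
    exact abs_cutoff_succ_mul_sub_le hε n
  -- For n = 0, 1 the truncated n - 1 is 0 and √0 kills the weight, so n ↦ n - 2 is injective on the
  -- support.
  have hinj : ∀ n < 2, starRingEnd ℂ μ * ((Real.sqrt ((n - 1 : ℕ) : ℝ) * Real.sqrt (n : ℝ) *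
      (cutoff ε (n - 1) - cutoff ε n) : ℝ) : ℂ) = 0 := by
    intro n hn
    have : n - 1 = 0 := by omega
    simp [this]
  refine ⟨weightedComp _ (fun n => n - 2) _ b1 (injOn_pred hinj) +
    weightedComp _ id _ b2 Function.injective_id.injOn, ?_, fun {v vc} hc => ?_⟩
  · refine (norm_add_le _ _).trans ((add_le_add (norm_weightedComp_le _ _)
      (norm_weightedComp_le _ _)).trans_eq ?_)
    ring
  · ext n
    change (Real.sqrt n : ℂ) * testOperator hε μ v (n - 1) = testOperator hε μ vc n +
      (starRingEnd ℂ μ * ((Real.sqrt ((n - 1 : ℕ) : ℝ) * Real.sqrt (n : ℝ) *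
      (cutoff ε (n - 1) - cutoff ε n) : ℝ) : ℂ) * v (n - 2) + -μ *
      ((((n : ℝ) + 1) * cutoff ε (n + 1) - n * cutoff ε n : ℝ) : ℂ) * v n)
    rw [testOperator_apply, testOperator_apply, ← hc]
    have e1 := ofReal_sqrt_mul_self (by positivity : (0 : ℝ) ≤ (n : ℝ) + 1)
    have e2 := ofReal_sqrt_mul_self (by positivity : (0 : ℝ) ≤ (n : ℝ))
    have e3 : creation v (n + 1) = (Real.sqrt (n + 1) : ℂ) * v n := by simp [creation]
    have e4 : creation v (n - 1) = (Real.sqrt ((n - 1 : ℕ) : ℝ) : ℂ) * v (n - 2) := by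
      simp [creation, Nat.sub_sub]
    rw [e3, e4]
    rcases n with _ | n
    · simp [ladderWeight]
    · simp only [ladderWeight, Nat.add_sub_cancel, Nat.reduceSubDiff]
      push_cast at e1 e2 ⊢
      linear_combination (μ * cutoff ε (n + 1) * v (n + 1)) * e2 -
        (μ * cutoff ε (n + 1 + 1) * v (n + 1)) * e1

/-- The test operator is a contraction for the Lipschitz seminorm `‖[D, ·]‖`. -/
lemma exists_isCommutator_testOperator (θ : ℝ)
    (hμ : Real.sqrt (2 / θ) * (‖μ‖ * (1 + 2 * ε)) ≤ 1) : ∃ C : DoubledL2 →L[ℂ] DoubledL2,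
      SpectralTriple.IsCommutator (dirac θ) (doubled (testOperator hε μ)) C ∧ ‖C‖ ≤ 1 := by
  obtain ⟨A, hA, hA'⟩ := exists_annihilation_commutator hε μ
  obtain ⟨B, hB, hB'⟩ := exists_creation_commutator hε μ
  set M : ℝ := ‖μ‖ * (1 + 2 * ε)
  have hM : 0 ≤ M := by positivity
  let C₀ : DoubledL2 →L[ℂ] DoubledL2 :=
    -- Up to the factor √(2/θ), the commutator is the off-diagonal block operator with entries A and
    -- B, of norm at most the larger of their norms.
    (WithLp.prodContinuousLinearEquiv 2 ℂ L2 L2).symm.toContinuousLinearMap ∘L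
      ((A ∘L ContinuousLinearMap.snd ℂ L2 L2).prod (B ∘L ContinuousLinearMap.fst ℂ L2 L2)) ∘L
      (WithLp.prodContinuousLinearEquiv 2 ℂ L2 L2).toContinuousLinearMap
  have hC₀ : ∀ u v : L2, C₀ (WithLp.toLp 2 (u, v)) = WithLp.toLp 2 (A v, B u) := fun _ _ => rfl
  have hC₀n : ‖C₀‖ ≤ M := by
    refine ContinuousLinearMap.opNorm_le_bound _ hM ?_
    rintro ⟨u, v⟩
    refine le_of_sq_le_sq ?_ (by positivity)
    rw [hC₀, WithLp.prod_norm_sq_eq_of_L2, mul_pow, WithLp.prod_norm_sq_eq_of_L2]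
    have h1 : ‖A v‖ ≤ M * ‖v‖ := A.le_of_opNorm_le hA v
    have h2 : ‖B u‖ ≤ M * ‖u‖ := B.le_of_opNorm_le hB u
    calc ‖A v‖ ^ 2 + ‖B u‖ ^ 2 ≤ (M * ‖v‖) ^ 2 + (M * ‖u‖) ^ 2 := by gcongr
      _ = M ^ 2 * (‖u‖ ^ 2 + ‖v‖ ^ 2) := by ring
  refine ⟨(Real.sqrt (2 / θ) : ℂ) • C₀, ?_, ?_⟩
  · rintro ⟨⟨u, v⟩, ⟨h1, h2⟩, h3, h4⟩
    obtain ⟨ua, k1⟩ : ∃ ua : L2, annihilation u = ua := ⟨⟨_, h1⟩, rfl⟩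
    obtain ⟨uc, k2⟩ : ∃ uc : L2, creation u = uc := ⟨⟨_, h2⟩, rfl⟩
    obtain ⟨va, k3⟩ : ∃ va : L2, annihilation v = va := ⟨⟨_, h3⟩, rfl⟩
    obtain ⟨vc, k4⟩ : ∃ vc : L2, creation v = vc := ⟨⟨_, h4⟩, rfl⟩
    refine ⟨toLp_mem_diracDomain (hA' k1) (hB' k2) (hA' k3) (hB' k4), ?_⟩
    have d1 := dirac_toLp θ (hB' k2) (hA' k3)
      (toLp_mem_diracDomain (hA' k1) (hB' k2) (hA' k3) (hB' k4))
    have d2 := dirac_toLp θ k2 k3 ⟨⟨h1, h2⟩, h3, h4⟩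
    refine (congrArg₂ (· - ·) d1 (congrArg (doubled (testOperator hε μ)) d2)).trans ?_
    simp only [map_smul, doubled_apply, smul_apply, hC₀, WithLp.toLp_fst, WithLp.toLp_snd]
    rw [← smul_sub, ← WithLp.toLp_sub, Prod.mk_sub_mk, add_sub_cancel_left, add_sub_cancel_left]
  · rw [norm_smul, Complex.norm_real, Real.norm_of_nonneg (Real.sqrt_nonneg _)]
    exact le_trans (by gcongr) hμ

end TestOperator

/-! ### The distance is at least the length of the translation -/

lemma hasSum_inner_coord (u v : L2) :
    HasSum (fun n => (inner ℂ (u n) (v n) : ℂ)) (inner ℂ u v) :=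
  lp.hasSum_inner u v

lemma norm_cutoff_mul_le {ε : ℝ} (hε : 0 ≤ ε) (n : ℕ) (x : ℂ) :
    ‖(cutoff ε n : ℂ) * x‖ ≤ ‖x‖ := by
  rw [norm_mul, Complex.norm_real, Real.norm_of_nonneg (cutoff_nonneg _ _)]
  exact mul_le_of_le_one_left (norm_nonneg _) (cutoff_le_one hε _)

/-- Dominated convergence, as 0 ≤ cutoff ≤ 1. The offset i takes the values 1 for the lowering part
and 0 for the raising part. -/
lemma tendsto_inner_cutoff (u v : L2) (i : ℕ) :
    Filter.Tendsto (fun ε => ∑' n, (cutoff ε (n + i) : ℂ) * inner ℂ (u n) (v n))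
      (nhdsWithin 0 (Set.Ioi 0)) (nhds (inner ℂ u v)) := by
  have hs := hasSum_inner_coord u v
  have h1 : (inner ℂ u v : ℂ) = ∑' n, (1 : ℂ) * inner ℂ (u n) (v n) := by
    simp only [one_mul]; exact hs.tsum_eq.symm
  rw [h1]
  refine tendsto_tsum_of_dominated_convergence
    (bound := fun n => ‖(inner ℂ (u n) (v n) : ℂ)‖) hs.summable.norm (fun n => ?_) ?_
  · refine Filter.Tendsto.mul_const _ ?_
    rw [← Complex.ofReal_one]
    exact (Complex.continuous_ofReal.tendsto 1).comp (tendsto_cutoff (n + i))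
  · filter_upwards [self_mem_nhdsWithin] with ε hε n
    exact norm_cutoff_mul_le (le_of_lt hε) _ _

lemma inner_testOperator {ε : ℝ} (hε : 0 < ε) (μ : ℂ) {v va vc : L2} (ha : annihilation v = va)
    (hc : creation v = vc) : inner ℂ v (testOperator hε μ v) =
      μ * ∑' n, (cutoff ε (n + 1) : ℂ) * inner ℂ (v n) (va n) +
        starRingEnd ℂ μ * ∑' n, (cutoff ε (n + 0) : ℂ) * inner ℂ (v n) (vc n) := by
  have hs : ∀ (x : L2) (i : ℕ), Summable fun n => (cutoff ε (n + i) : ℂ) * inner ℂ (v n) (x n) :=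
    fun x i => Summable.of_norm_bounded (hasSum_inner_coord v x).summable.norm
      fun n => norm_cutoff_mul_le hε.le _ _
  rw [← (hasSum_inner_coord _ _).tsum_eq, ← tsum_mul_left, ← tsum_mul_left,
    ← ((hs va 1).mul_left _).tsum_add ((hs vc 0).mul_left _)]
  refine tsum_congr fun n => ?_
  rw [testOperator_eq_of_ladder hε μ ha hc]
  simp only [RCLike.inner_apply, add_zero]
  ring

/-- The expectation of `f` in the state of `T(z) v`. -/
def expectation (θ : ℝ) (f : L2 →L[ℂ] L2) (z : ℂ) (v : L2) : ℂ :=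
  inner ℂ (translation θ z v) (f (translation θ z v))

/-- This replaces an estimate of cross terms: a perturbation of the vector is then controlled by
bounds on the quadratic form alone. -/
lemma expectation_parallelogram (θ : ℝ) (f : L2 →L[ℂ] L2) (z : ℂ) (u v : L2) :
    expectation θ f z (u + v) + expectation θ f z (u - v) =
      2 * (expectation θ f z u + expectation θ f z v) := by
  simp only [expectation, map_add, map_sub, inner_add_left, inner_add_right, inner_sub_left,
    inner_sub_right]
  ring

/-- The covariance of the position operator `μ 𝔞 + μ̄ 𝔞†` under translations, in the limit of the
test operators. -/
lemma tendsto_expectation_sub (θ : ℝ) {u ua uc : L2} (ha : annihilation u = ua)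
    (hc : creation u = uc) (z z' μ₀ : ℂ) :
    Filter.Tendsto (fun ε : ℝ => if hε : 0 < ε then
        expectation θ (testOperator hε (((1 + 2 * ε)⁻¹ : ℝ) * μ₀)) z u -
          expectation θ (testOperator hε (((1 + 2 * ε)⁻¹ : ℝ) * μ₀)) z' u else 0)
      (nhdsWithin 0 (Set.Ioi 0))
      (nhds (scale θ * (μ₀ * (z - z') + starRingEnd ℂ (μ₀ * (z - z'))) * (‖u‖ ^ 2 : ℝ))) := by
  have hμ : Filter.Tendsto (fun ε : ℝ => (((1 + 2 * ε)⁻¹ : ℝ) : ℂ) * μ₀)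
      (nhdsWithin 0 (Set.Ioi 0)) (nhds μ₀) := by
    have h : ContinuousAt (fun ε : ℝ => (1 + 2 * ε)⁻¹) 0 :=
      ContinuousAt.inv₀ (by fun_prop) (by norm_num)
    have h1 := (Complex.continuous_ofReal.continuousAt.comp h).mul_const μ₀
    have h2 := h1.tendsto.mono_left (nhdsWithin_le_nhds (s := Set.Ioi 0))
    simpa using h2
  have hμ' := (Complex.continuous_conj.tendsto μ₀).comp hμ
  -- The terms ⟨u, ua⟩ and ⟨u, uc⟩ do not depend on z and cancel in the difference. The value 0 for
  -- ε ≤ 0 is a filler that the filter never sees; the factor (1 + 2ε)⁻¹ compensates the commutator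
  -- bound and tends to 1.
  have key : ∀ z : ℂ, Filter.Tendsto (fun ε : ℝ => if hε : 0 < ε then
      expectation θ (testOperator hε (((1 + 2 * ε)⁻¹ : ℝ) * μ₀)) z u else 0)
      (nhdsWithin 0 (Set.Ioi 0))
      (nhds (μ₀ * inner ℂ u ua + starRingEnd ℂ μ₀ * inner ℂ u uc +
        scale θ * (μ₀ * z + starRingEnd ℂ (μ₀ * z)) * (‖u‖ ^ 2 : ℝ))) := by
    intro z
    have hva := annihilation_translation θ z ha
    have hvc := creation_translation θ z hc
    have h := (hμ.mul (tendsto_inner_cutoff (translation θ z u)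
      (translation θ z ua + (z * scale θ) • translation θ z u) 1)).add
      (hμ'.mul (tendsto_inner_cutoff (translation θ z u)
      (translation θ z uc + (starRingEnd ℂ z * scale θ) • translation θ z u) 0))
    refine Filter.Tendsto.congr' ?_ (h.trans_eq ?_)
    · filter_upwards [self_mem_nhdsWithin] with ε hε
      rw [dif_pos (Set.mem_Ioi.1 hε), expectation, inner_testOperator hε _ hva hvc]
      rfl
    · simp only [inner_add_right, inner_smul_right, LinearIsometryEquiv.inner_map_map,
        inner_self_eq_norm_sq_to_K, map_mul,
        LinearIsometryEquiv.norm_map, Complex.coe_algebraMap]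
      congr 1
      push_cast
      ring
  refine ((key z).sub (key z')).congr' ?_ |>.trans_eq ?_
  · filter_upwards [self_mem_nhdsWithin] with ε hε
    simp only [dif_pos (Set.mem_Ioi.1 hε)]
  · congr 1
    simp only [mul_sub, map_sub]
    ring

lemma expectation_sub_le {θ : ℝ} (hθ : 0 < θ) {f : L2 →L[ℂ] L2} {C : DoubledL2 →L[ℂ] DoubledL2}
    (hC : SpectralTriple.IsCommutator (dirac θ) (doubled f) C) (hC1 : ‖C‖ ≤ 1) (z z' : ℂ) (ψ : L2) :
    |(expectation θ f z ψ - expectation θ f z' ψ).re| ≤ ‖z - z'‖ * ‖ψ‖ ^ 2 :=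
  (Complex.abs_re_le_norm _).trans (norm_expectation_sub_le hθ hC hC1 z z' ψ)

/-- There are Lipschitz test operators which nearly realise the length of a translation, in every
vector state. -/
lemma exists_lt_expectation_sub {θ : ℝ} (hθ : 0 < θ) {ψ : L2} (hψ : ‖ψ‖ = 1) {z z' : ℂ} {r : ℝ}
    (hr : r < ‖z - z'‖) : ∃ f : L2 →L[ℂ] L2, RapidDecay (entry f) ∧ IsSelfAdjoint f ∧
      (∃ C : DoubledL2 →L[ℂ] DoubledL2,
        SpectralTriple.IsCommutator (dirac θ) (doubled f) C ∧ ‖C‖ ≤ 1) ∧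
      r < (expectation θ f z ψ - expectation θ f z' ψ).re := by
  set w := z - z' with hw
  set δ := ‖w‖ - r with hδ
  have hδ0 : 0 < δ := sub_pos.2 hr
  have hs : 0 < Real.sqrt (θ / 2) := Real.sqrt_pos.2 (by positivity)
  have hinv : Real.sqrt (2 / θ) * Real.sqrt (θ / 2) = 1 := by
    rw [← Real.sqrt_mul (by positivity), div_mul_div_comm, mul_comm 2 θ, div_self (by positivity),
      Real.sqrt_one]
  -- The phase makes μ₀w real and nonnegative; the modulus is the largest with √(2/θ)|μ₀| ≤ 1. For w
  -- = 0 the quotient is 0 by convention.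
  set μ₀ : ℂ := Real.sqrt (θ / 2) * (starRingEnd ℂ w / ‖w‖) with hμ₀
  have hμ₀n : ‖μ₀‖ ≤ Real.sqrt (θ / 2) := by
    rw [hμ₀, norm_mul, Complex.norm_real, Real.norm_of_nonneg hs.le, norm_div, RCLike.norm_conj,
      Complex.norm_real, norm_norm]
    exact mul_le_of_le_one_right hs.le (div_self_le_one _)
  have hμ₀w : μ₀ * w = (Real.sqrt (θ / 2) * ‖w‖ : ℝ) := by
    rcases eq_or_ne w 0 with h | h
    · simp [h]
    · have h1 : (‖w‖ : ℂ) ≠ 0 := by simpa using h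
      rw [hμ₀, mul_assoc, div_mul_eq_mul_div, Complex.conj_mul', pow_two, mul_div_assoc,
        div_self h1, mul_one]
      push_cast
      rfl
  have hlim : scale θ * (μ₀ * w + starRingEnd ℂ (μ₀ * w)) = (‖w‖ : ℝ) := by
    rw [hμ₀w, Complex.conj_ofReal, scale, show 2 * θ = 2 ^ 2 * (θ / 2) by ring,
      Real.sqrt_mul (by positivity), Real.sqrt_sq (by positivity)]
    have : (Real.sqrt (θ / 2) : ℂ) ≠ 0 := Complex.ofReal_ne_zero.2 hs.ne'
    push_cast
    field_simp
    ring
  obtain ⟨u, hu, hψu⟩ : ∃ u ∈ Submodule.span ℂ (Set.range ket),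
      4 * ‖w‖ * ‖ψ - u‖ ^ 2 < δ / 2 := by
    have hcont : Continuous fun u : L2 => 4 * ‖w‖ * ‖ψ - u‖ ^ 2 := by fun_prop
    have hopen : IsOpen {u : L2 | 4 * ‖w‖ * ‖ψ - u‖ ^ 2 < δ / 2} :=
      isOpen_lt hcont continuous_const
    obtain ⟨u, h1, h2⟩ := dense_span_ket.exists_mem_open hopen ⟨ψ, by simpa using hδ0⟩
    exact ⟨u, h1, h2⟩
  obtain ⟨ua, uc, ha, hc, -⟩ := exists_ladder_of_mem_span θ hu
  have ht := (Complex.continuous_re.tendsto _).comp (tendsto_expectation_sub θ ha hc z z' μ₀)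
  rw [← hw, hlim, ← Complex.ofReal_mul, Complex.ofReal_re] at ht
  have hev := ht.eventually_const_lt (show ‖w‖ * ‖u‖ ^ 2 - δ / 4 < ‖w‖ * ‖u‖ ^ 2 by linarith)
  obtain ⟨ε, h1, hε : 0 < ε⟩ := (hev.and self_mem_nhdsWithin).exists
  simp only [Function.comp_apply, dif_pos hε] at h1
  set μ : ℂ := (((1 + 2 * ε)⁻¹ : ℝ) : ℂ) * μ₀ with hμ
  have hμn : Real.sqrt (2 / θ) * (‖μ‖ * (1 + 2 * ε)) ≤ 1 := by
    have h0 : (0 : ℝ) < 1 + 2 * ε := by positivity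
    rw [hμ, norm_mul, Complex.norm_real, Real.norm_of_nonneg (by positivity), mul_right_comm,
      inv_mul_cancel₀ h0.ne', one_mul, ← hinv]
    gcongr
  obtain ⟨C, hC, hC1⟩ := exists_isCommutator_testOperator hε μ θ hμn
  refine ⟨testOperator hε μ, rapidDecay_testOperator hε μ, isSelfAdjoint_testOperator hε μ,
    ⟨C, hC, hC1⟩, ?_⟩
  set f := testOperator hε μ
  set e := ψ - u with he
  -- Let Q be the difference of the expectations at z and z'. Then Q(ψ) = 2Q(u) + 2Q(e) - Q(u - e),
  -- with |Q(x)| ≤ |w|‖x‖² and ‖u - e‖² = 2‖u‖² + 2‖e‖² - 1. The terms in ‖u‖² cancel, leaving Q(ψ)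
  -- > |w| - δ/2 - 4|w|‖e‖² > |w| - δ = r, which explains the constants 4, δ/2 and δ/4 above.
  have p1 := (abs_le.1 (expectation_sub_le hθ hC hC1 z z' e)).1
  have p2 := (abs_le.1 (expectation_sub_le hθ hC hC1 z z' (u - e))).2
  have p3 := congrArg Complex.re (congrArg₂ (· - ·) (expectation_parallelogram θ f z u e)
    (expectation_parallelogram θ f z' u e))
  have p4 := parallelogram_law_with_norm ℂ u e
  rw [show u + e = ψ by rw [he]; abel] at p3 p4
  rw [hψ] at p4
  simp only [Complex.sub_re, Complex.add_re, Complex.mul_re, Complex.re_ofNat, Complex.im_ofNat,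
    zero_mul, sub_zero] at p1 p2 p3 h1 ⊢
  have p5 : ‖w‖ * ‖u - e‖ ^ 2 = ‖w‖ * (2 * (‖u‖ ^ 2 + ‖e‖ ^ 2) - 1) := by
    congr 1
    linarith
  rw [p5] at p2
  linarith

end

end Moyal

/-! ### The distance formula -/

theorem mainTheorem6 (θ : ℝ) (hθ : 0 < θ) (ψ₀ : Moyal.L2) (hψ₀ : ‖ψ₀‖ = 1) (z z' : ℂ) :
    SpectralTriple.spectralDistance Moyal.schrodingerRep (Moyal.dirac θ)
      (Moyal.coherentState θ ψ₀ z) (Moyal.coherentState θ ψ₀ z') = ((‖z - z'‖ : ℝ) : EReal) := by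
  refine le_antisymm (iSup_le ?_) (EReal.ge_of_forall_gt_iff_ge.1 fun r hr => ?_)
  · rintro ⟨a, -, C, hC, hC1⟩
    have h := (abs_le.1 (Moyal.expectation_sub_le hθ hC hC1 z z' ψ₀)).2
    rw [hψ₀, one_pow, mul_one] at h
    exact EReal.coe_le_coe_iff.2 h
  -- The supremum is only approached: each real r below the length is beaten by its own test
  -- operator.
  · obtain ⟨f, hf, hsa, hC, hlt⟩ :=
      Moyal.exists_lt_expectation_sub hθ hψ₀ (EReal.coe_lt_coe_iff.1 hr)
    refine (EReal.coe_le_coe_iff.2 hlt.le).trans ?_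
    exact le_iSup (fun a : {a : Moyal.rapidDecayAlgebra // IsSelfAdjoint a ∧
      ∃ C, SpectralTriple.IsCommutator (Moyal.dirac θ) (Moyal.schrodingerRep a) C ∧ ‖C‖ ≤ 1} =>
      ((Moyal.coherentState θ ψ₀ z a - Moyal.coherentState θ ψ₀ z' a).re : EReal))
      ⟨⟨f, hf⟩, Subtype.ext hsa, hC⟩
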